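/- Let $K$ be a field and let $L$ be a finite distributive lattice with at least three elements. Let $P$ be the poset of join-irreducible elements of $L$ (so $L\cong\mathcal J(P)$, the lattice of down-sets of $P$). The dimension of $L$ is the width of $P$ (the largest cardinality of an antichain of $P$), and $L$ is called planar if its dimension is at most $2$. Label the elements of $L$ other than its minimum and maximum by variables $t_1,\dots,t_s$. For a maximal chain $C$ of $L$ let $t_C\in K[t_1,\dots,t_s]$ be the product of the variables that belong to $C$. The chain algebra $K[\mathcal C_L]$ is the $K$-subalgebra of $K[t_1,\dots,t_s]$ generated by all $t_C$, and its defining ideal is the kernel of the $K$-algebra map $K[T_C : C \text{ a maximal chain of } L]\to K[t_1,\dots,t_s]$, $T_C\mapsto t_C$. For monomials $u,v$ of degree $r\ge 1$ write $uv=t_{i_1}t_{i_2}\cdots t_{i_{2r}}$ with $i_1\le i_2\le\dots\le i_{2r}$ and put $\operatorname{sort}(u,v)=(t_{i_1}t_{i_3}\cdots t_{i_{2r-1}},\ t_{i_2}t_{i_4}\cdots t_{i_{2r}})$. A set $B$ of monomials of degree $r$ is sortable if $\operatorname{sort}(B\times B)\subseteq B\times B$. The lattice $L$ is sortable if, for some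 labelling of the variables by $t_1,\dots,t_s$, the set of all $t_C$ is sortable. For a finite nonempty distributive lattice $M$, the Hibi ring $K[M]$ is $K[x_a : a\in M]$ modulo the ideal generated by all $x_ax_b-x_{a\wedge b}x_{a\vee b}$ with $a,b\in M$. The following are equivalent: 1. $L$ is planar; 2. $L$ is sortable; 3. for some enumeration $C_1,\dots,C_m$ of the maximal chains of $L$, the defining ideal of $K[\mathcal C_L]$ in $K[T_1,\dots,T_m]$ ($T_i\mapsto t_{C_i}$) has a Gröbner basis consisting of homogeneous polynomials of degree $2$ with respect to the degree reverse lexicographic order with $T_1>\dots>T_m$; 4. the defining ideal of $K[\mathcal C_L]$ is generated by homogeneous polynomials of degree $2$; 5. $K[\mathcal C_L]$ is isomorphic as a $K$-algebra to the Hibi ring of some finite nonempty distributive lattice. Moreover, if $L$ is planar, then $P$ is the disjoint union of two (possibly empty) chains $A$ and $B$. For every such decomposition $P=A\sqcup B$, write $t_{ij}$ for the element $x\in L$ with $i=|\{p\in A: p\le x\}|$ and $j=|\{p\in B: p\le x\}|$, which has rank $i+j$, and for maximal chains $C,D$ of $L$ put $C\preceq D$ if, at every rank, the elements $t_{ij}\in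 C$ and $t_{kl}\in D$ of that rank satisfy $i\le k$. Then the set $L'$ of maximal chains of $L$, ordered by $\preceq$, is a distributive lattice, and $x_C\mapsto t_C$ defines an isomorphism of $K$-algebras $K[L']\cong K[\mathcal C_L]$. Furthermore, for every enumeration $C_1,\dots,C_m$ of the maximal chains such that $C_i\preceq C_j$ implies $i\le j$, the defining ideal has a Gröbner basis as in 3. -/

import Mathlib

/-! ### The degree reverse lexicographic order -/

/-- Exponent vectors in `m` variables, as a type synonym carrying the degree reverse
lexicographic order. -/
def DegRevLex (m : ℕ) : Type := Fin m →₀ ℕ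

namespace DegRevLex

/-- The synonym map. -/
def of {m : ℕ} : (Fin m →₀ ℕ) ≃ DegRevLex m := Equiv.refl _

noncomputable instance {m : ℕ} : AddCommMonoid (DegRevLex m) :=
  inferInstanceAs (AddCommMonoid (Fin m →₀ ℕ))

/-- Total degree first; ties are broken by the last entry in which two vectors differ,
the vector with the smaller entry being the larger one. -/
noncomputable def key {m : ℕ} (a : DegRevLex m) : ℕ ×ₗ Colex (Fin m → ℕᵒᵈ) :=
  toLex ((of.symm a).degree, toColex (fun i => OrderDual.toDual (of.symm a i)))

theorem key_injective {m : ℕ} : Function.Injective (key (m := m)) := by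
  intro a b h
  have h2 := congrArg (fun p => ofColex (ofLex p).2) h
  apply of.symm.injective
  ext i
  exact congrArg OrderDual.ofDual (congrFun h2 i)

noncomputable instance {m : ℕ} : LinearOrder (DegRevLex m) :=
  LinearOrder.lift' key key_injective

/-- `a < b` in the degree reverse lexicographic order (with `T_0 > T_1 > ⋯ > T_{m-1}`) iff
`deg a < deg b`, or the degrees agree and the last nonzero entry of `b - a` is negative. -/
theorem lt_iff {m : ℕ} {a b : Fin m →₀ ℕ} :
    of a < of b ↔ a.degree < b.degree ∨
      (a.degree = b.degree ∧ ∃ i, (∀ j, i < j → a j = b j) ∧ b i < a i) := by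
  change key (of a) < key (of b) ↔ _
  unfold key
  rw [Prod.Lex.toLex_lt_toLex]
  exact Iff.rfl

theorem add_lt_add_iff {m : ℕ} {a b : Fin m →₀ ℕ} (c : Fin m →₀ ℕ) :
    of (c + a) < of (c + b) ↔ of a < of b := by
  simp [lt_iff]

theorem add_le_add_iff {m : ℕ} {a b : Fin m →₀ ℕ} (c : Fin m →₀ ℕ) :
    of (c + a) ≤ of (c + b) ↔ of a ≤ of b := by
  rw [← not_lt, add_lt_add_iff, not_lt]

instance {m : ℕ} : IsOrderedAddMonoid (DegRevLex m) where
  add_le_add_left a b h c := by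
    rw [add_comm a c, add_comm b c]
    exact (add_le_add_iff (of.symm c)).2 h

theorem of_monotone {m : ℕ} : Monotone (of (m := m)) := by
  intro a b h
  rcases eq_or_ne a b with rfl | hne
  · exact le_rfl
  obtain ⟨c, rfl⟩ := exists_add_of_le h
  have hc : c ≠ 0 := fun hc => hne (by simp [hc])
  refine (lt_iff.2 (Or.inl ?_)).le
  have : c.degree ≠ 0 := fun h0 => hc ((Finsupp.degree_eq_zero_iff c).1 h0)
  rw [map_add]
  omega

instance {m : ℕ} : WellFoundedLT (DegRevLex m) := by
  have : WellQuasiOrderedLE (DegRevLex m) :=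
    of_monotone.wellQuasiOrderedLE_of_wellQuasiOrderedLE_of_surjective of.surjective
  infer_instance

end DegRevLex

/-- The degree reverse lexicographic monomial order with `T_0 > T_1 > ⋯ > T_{m-1}`. -/
noncomputable def degRevLex (m : ℕ) : MonomialOrder (Fin m) where
  syn := DegRevLex m
  toSyn := { DegRevLex.of with map_add' := fun _ _ => rfl }
  toSyn_monotone := DegRevLex.of_monotone

/-! ### Generators of ideals and Gröbner bases -/

section Ideals

variable {σ K : Type*} [Field K]

/-- The initial ideal: the ideal generated by the leading monomials of the nonzero elements
of a set of polynomials. -/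
noncomputable def initialIdeal (o : MonomialOrder σ) (S : Set (MvPolynomial σ K)) :
    Ideal (MvPolynomial σ K) :=
  Ideal.span {t | ∃ f ∈ S, f ≠ 0 ∧ t = MvPolynomial.monomial (o.degree f) 1}

/-- `G` is a Gröbner basis of the ideal `I` with respect to the monomial order `o`. -/
def IsGroebnerBasis (o : MonomialOrder σ) (G : Set (MvPolynomial σ K))
    (I : Ideal (MvPolynomial σ K)) : Prop :=
  G.Finite ∧ G ⊆ I ∧ initialIdeal o G = initialIdeal o (I : Set (MvPolynomial σ K))

/-- `I` has a Gröbner basis with respect to `o` consisting of quadratic forms. -/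
def HasQuadraticGroebnerBasis (o : MonomialOrder σ) (I : Ideal (MvPolynomial σ K)) : Prop :=
  ∃ G : Set (MvPolynomial σ K), (∀ g ∈ G, g.IsHomogeneous 2) ∧ IsGroebnerBasis o G I

/-- `I` is generated by quadratic forms. -/
def IsQuadraticallyGenerated (I : Ideal (MvPolynomial σ K)) : Prop :=
  ∃ G : Set (MvPolynomial σ K), (∀ g ∈ G, g.IsHomogeneous 2) ∧ I = Ideal.span G

end Ideals

/-- The toric ideal of a family of monomials `t^{u i}`: the kernel of the `K`-algebra
homomorphism `T_i ↦ t^{u i}`. -/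
noncomputable def toricIdeal (K : Type*) [Field K] {ι σ : Type*} (u : ι → (σ →₀ ℕ)) :
    Ideal (MvPolynomial ι K) :=
  RingHom.ker (MvPolynomial.aeval (R := K)
    (fun i => (MvPolynomial.monomial (u i) 1 : MvPolynomial σ K)))

/-! ### Hibi rings -/

section Hibi

variable (K : Type*) [Field K] (M : Type*) [Lattice M]

/-- The ideal generated by the Hibi relations `x_a x_b - x_{a ∧ b} x_{a ∨ b}`. -/
noncomputable def hibiIdeal : Ideal (MvPolynomial M K) :=
  Ideal.span {f | ∃ a b : M, f = MvPolynomial.X a * MvPolynomial.X b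
    - MvPolynomial.X (a ⊓ b) * MvPolynomial.X (a ⊔ b)}

/-- The Hibi ring of a lattice. -/
abbrev HibiRing : Type _ := MvPolynomial M K ⧸ hibiIdeal K M

end Hibi

/-- A `K`-algebra is a Hibi ring if it is isomorphic to the Hibi ring of a finite (nonempty)
distributive lattice. -/
def IsHibiRing (K : Type*) [Field K] (R : Type*) [CommRing R] [Algebra K R] : Prop :=
  ∃ (M : Type) (_ : DistribLattice M), Finite M ∧ Nonempty M ∧ Nonempty (R ≃ₐ[K] HibiRing K M)

/-! ### Sortable sets of monomials -/

/-- The entries in odd positions (first, third, …) and in even positions of a list. -/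
def alternate {α : Type*} : List α → List α × List α
  | [] => ([], [])
  | a :: l => (a :: (alternate l).2, (alternate l).1)

/-- The sorting of a pair of monomials (given by their exponent vectors): write the product as
`t_{i_1} t_{i_2} ⋯ t_{i_{2r}}` with `i_1 ≤ i_2 ≤ ⋯` and take the monomials
`t_{i_1} t_{i_3} ⋯` and `t_{i_2} t_{i_4} ⋯`. -/
noncomputable def sortPair {s : ℕ} (u v : Fin s →₀ ℕ) : (Fin s →₀ ℕ) × (Fin s →₀ ℕ) :=
  let p := alternate ((Finsupp.toMultiset (u + v)).sort (· ≤ ·))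
  (Multiset.toFinsupp (p.1 : Multiset (Fin s)), Multiset.toFinsupp (p.2 : Multiset (Fin s)))

/-- A set of monomials of a common positive degree is sortable if it is closed under sorting of
pairs. -/
def IsSortable {s : ℕ} (B : Set (Fin s →₀ ℕ)) : Prop :=
  (∃ r : ℕ, 0 < r ∧ ∀ u ∈ B, u.degree = r) ∧
    ∀ u ∈ B, ∀ v ∈ B, (sortPair u v).1 ∈ B ∧ (sortPair u v).2 ∈ B

/-! ### Width, dimension and planarity -/

/-- The width of a poset: the supremum of the cardinalities of its antichains. -/
noncomputable def posetWidth (P : Type*) [PartialOrder P] : ℕ∞ :=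
  ⨆ s : {s : Set P // IsAntichain (· ≤ ·) s}, s.1.encard

/-- The poset of join-irreducible elements of a lattice. -/
abbrev JoinIrr (L : Type*) [Lattice L] : Type _ := {p : L // SupIrred p}

/-- The dimension of a finite distributive lattice `L ≅ J(P)` is the width of `P`, the poset of
join-irreducible elements. -/
noncomputable def latticeDim (L : Type*) [DistribLattice L] : ℕ∞ := posetWidth (JoinIrr L)

/-- A finite distributive lattice is planar if its dimension is at most two. -/
def IsPlanarLattice (L : Type*) [DistribLattice L] : Prop := latticeDim L ≤ 2

/-! ### Chain algebras -/

/-- The maximal chains of a poset. -/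
def MaxChain (L : Type*) [PartialOrder L] : Type _ := {C : Set L // IsMaxChain (· ≤ ·) C}

section ChainAlgebra

variable (K : Type*) [Field K] {L : Type*} [DistribLattice L] [BoundedOrder L] [Finite L]

variable (L) in
/-- The elements of `L` other than the minimum and the maximum; they index the variables. -/
def Interior : Type _ := {x : L // x ≠ ⊥ ∧ x ≠ ⊤}

instance : Finite (Interior L) := inferInstanceAs (Finite {x : L // x ≠ ⊥ ∧ x ≠ ⊤})

open Classical in
/-- The exponent vector of `t_C`, the product of the variables indexed by the elements of the
maximal chain `C` other than the minimum and the maximum of `L`. -/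
noncomputable def chainExponent (C : MaxChain L) : Interior L →₀ ℕ :=
  Finsupp.equivFunOnFinite.symm (fun x => if x.1 ∈ C.1 then 1 else 0)

/-- The monomial `t_C`. -/
noncomputable def chainMonomial (C : MaxChain L) : MvPolynomial (Interior L) K :=
  MvPolynomial.monomial (chainExponent C) 1

variable (L) in
/-- The chain algebra of `L`: the subalgebra generated by all the monomials `t_C`. -/
noncomputable def chainAlgebra : Subalgebra K (MvPolynomial (Interior L) K) :=
  Algebra.adjoin K (Set.range (chainMonomial K (L := L)))

variable (L) in
/-- `L` is sortable if, for some labelling `t_1, …, t_s` of the variables, the set of monomials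
`t_C` is sortable. -/
def IsSortableLattice : Prop :=
  ∃ (s : ℕ) (label : Interior L ≃ Fin s),
    IsSortable (Set.range fun C : MaxChain L => (chainExponent C).mapDomain label)

variable (L) in
/-- The defining ideal of the chain algebra, in the polynomial ring with one variable for each
maximal chain of `L`. -/
noncomputable def chainIdeal : Ideal (MvPolynomial (MaxChain L) K) :=
  toricIdeal K (chainExponent (L := L))

/-- The defining ideal of the chain algebra in `K[T_0, …, T_{m-1}]`, for an enumeration
`C_0, …, C_{m-1}` of the maximal chains. -/
noncomputable def chainIdealEnum {m : ℕ} (C : Fin m ≃ MaxChain L) :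
    Ideal (MvPolynomial (Fin m) K) :=
  toricIdeal K (fun i => chainExponent (C i))

end ChainAlgebra

/-! ### The order on maximal chains of a planar lattice -/

section Grid

variable {L : Type*} [DistribLattice L]

/-- The poset of join-irreducible elements is the disjoint union of the two chains `A`, `B`. -/
def IsChainCover (A B : Set (JoinIrr L)) : Prop :=
  IsChain (· ≤ ·) A ∧ IsChain (· ≤ ·) B ∧ Disjoint A B ∧ A ∪ B = Set.univ

/-- The number of elements of `A` below `x`. With a cover of the join-irreducible elements by two
disjoint chains `A`, `B`, the element `x` is `t_{ij}` with `i = coord A x` and `j = coord B x`, and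
`i + j` is its rank. -/
noncomputable def coord (A : Set (JoinIrr L)) (x : L) : ℕ :=
  {p | p ∈ A ∧ p.1 ≤ x}.ncard

/-- Componentwise order on maximal chains: at every rank, the element `t_{ij}` of `C` and the
element `t_{kl}` of `D` of that rank satisfy `i ≤ k`. -/
def ChainLE (A B : Set (JoinIrr L)) (C D : MaxChain L) : Prop :=
  ∀ c ∈ C.1, ∀ d ∈ D.1, coord A c + coord B c = coord A d + coord B d → coord A c ≤ coord A d

end Grid

/-! *Planar lattices.* If the join-irreducible elements are covered by two disjoint chains `A` and `B`
(which exist by Dilworth's theorem for width two, `exists_two_chains`), then `coord A` and `coord B`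
embed `L` into a grid, and a maximal chain is a lattice path, determined by the first coordinates of
its elements of each rank. Pointwise minimum and maximum of these coordinates make the set of
maximal chains a distributive lattice, `IsChainCover.chainLattice`, with
`t_C t_D = t_{C ∧ D} t_{C ∨ D}`. Since a multichain of maximal chains is determined by the product of
its monomials (`IsChainCover.hasUniqueMultichains`), each fibre of `T_C ↦ t_C` contains exactly one
monomial that is reduced with respect to the rules `T_C T_D → T_{C ∧ D} T_{C ∨ D}`. These rules
decrease every degree reverse lexicographic order given by a linear extension, so the binomials form
a quadratic Gröbner basis, and the defining ideal is the Hibi ideal. If the variables are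
labelled by rank and then by first coordinate, sorting `(t_C, t_D)` yields `(t_{C ∧ D}, t_{C ∨ D})`.

*Lattices that are not planar.* Three incomparable join-irreducible elements give a Boolean interval
of rank three. The maximal chains that agree outside of this interval correspond to the six edges of
a hexagon, whose two perfect matchings form a fibre of degree three without a common factor
(`Hexagon.isCubicFibre`). Its binomial is a cubic minimal generator, which rules out quadratic
generation and quadratic Gröbner bases. As two edges of a matching are alone in their fibre, they
would have to be sorted if `L` were sortable. Three pairwise sorted monomials are determined by their
product, so the two matchings would coincide.

*Hibi rings.* Let `K[T]/I ≅ K[x]/J` with `J` a Hibi ideal. The isomorphism need not respect the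
grading, but both irrelevant ideals have cotangent spaces of the largest possible dimension. Hence
the point of `K[x]/J` that corresponds to the origin has zero coordinates at all variables in
nontrivial Hibi relations, and a translation preserving `J` moves it to the origin. The
linear part of the translated isomorphism is then an isomorphism of graded algebras, so `I` is
generated by quadrics (`isQuadraticallyGenerated_of_algEquiv_hibiRing`). -/

/-! ### Toric ideals and their fibres -/

section Toric

variable {K : Type*} [Field K] {ι σ : Type*}

/-- The exponent vector of the image of the monomial `T^e` under `T_i ↦ t^{u i}`. -/
noncomputable def multidegree (u : ι → (σ →₀ ℕ)) : (ι →₀ ℕ) →ₗ[ℕ] (σ →₀ ℕ) :=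
  Finsupp.linearCombination ℕ u

theorem multidegree_single (u : ι → (σ →₀ ℕ)) (i : ι) :
    multidegree u (Finsupp.single i 1) = u i := by
  simp [multidegree]

theorem multidegree_apply [Fintype ι] (u : ι → (σ →₀ ℕ)) (e : ι →₀ ℕ) (x : σ) :
    multidegree u e x = ∑ i, e i * u i x := by
  rw [multidegree, Finsupp.linearCombination_apply, Finsupp.sum_fintype _ _ (by simp),
    Finsupp.finsetSum_apply]
  simp

theorem aeval_monomial_multidegree (u : ι → (σ →₀ ℕ)) (e : ι →₀ ℕ) (c : K) :
    MvPolynomial.aeval (R := K) (fun i => (MvPolynomial.monomial (u i) 1 : MvPolynomial σ K))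
      (MvPolynomial.monomial e c) = MvPolynomial.monomial (multidegree u e) c := by
  rw [MvPolynomial.aeval_monomial, multidegree, Finsupp.linearCombination_apply,
    MvPolynomial.monomial_finsupp_sum_index, MvPolynomial.algebraMap_eq]
  simp [MvPolynomial.monomial_pow]

open Classical in
theorem coeff_aeval_monomial (u : ι → (σ →₀ ℕ)) (f : MvPolynomial ι K) (w : σ →₀ ℕ) :
    (MvPolynomial.aeval (R := K)
      (fun i => (MvPolynomial.monomial (u i) 1 : MvPolynomial σ K)) f).coeff w
      = ∑ e ∈ f.support with multidegree u e = w, f.coeff e := by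
  conv_lhs => rw [f.as_sum]
  rw [map_sum, MvPolynomial.coeff_sum, Finset.sum_filter]
  refine Finset.sum_congr rfl fun e _ => ?_
  rw [aeval_monomial_multidegree, MvPolynomial.coeff_monomial]

open Classical in
/-- A polynomial lies in the toric ideal iff the coefficients over each fibre of the multidegree
sum to zero. -/
theorem mem_toricIdeal_iff {u : ι → (σ →₀ ℕ)} {f : MvPolynomial ι K} :
    f ∈ toricIdeal K u ↔ ∀ w, ∑ e ∈ f.support with multidegree u e = w, f.coeff e = 0 := by
  rw [toricIdeal, RingHom.mem_ker, MvPolynomial.ext_iff]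
  simp_rw [← coeff_aeval_monomial]
  rfl

theorem monomial_sub_monomial_mem_toricIdeal {u : ι → (σ →₀ ℕ)} {a b : ι →₀ ℕ}
    (h : multidegree u a = multidegree u b) :
    (MvPolynomial.monomial a 1 - MvPolynomial.monomial b 1 : MvPolynomial ι K)
      ∈ toricIdeal K u := by
  rw [toricIdeal, RingHom.mem_ker, map_sub]
  erw [aeval_monomial_multidegree, aeval_monomial_multidegree]
  rw [h, sub_self]

theorem exists_ne_of_mem_toricIdeal {u : ι → (σ →₀ ℕ)} {f : MvPolynomial ι K}
    (hf : f ∈ toricIdeal K u) {e : ι →₀ ℕ} (he : e ∈ f.support) :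
    ∃ e' ∈ f.support, e' ≠ e ∧ multidegree u e' = multidegree u e := by
  classical
  by_contra! h
  have h1 := mem_toricIdeal_iff.1 hf (multidegree u e)
  rw [Finset.sum_eq_single_of_mem e (by simpa using he)] at h1
  · exact (MvPolynomial.mem_support_iff.1 he) h1
  · intro b hb hbe
    exact absurd (Finset.mem_filter.1 hb).2 (h b (Finset.mem_filter.1 hb).1 hbe)

/-- The coefficient of a monomial that is alone in its fibre vanishes on the toric ideal. -/
theorem coeff_eq_zero_of_mem_toricIdeal {u : ι → (σ →₀ ℕ)} {f : MvPolynomial ι K}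
    (hf : f ∈ toricIdeal K u) {e : ι →₀ ℕ}
    (he : ∀ e', multidegree u e' = multidegree u e → e' = e) : f.coeff e = 0 := by
  by_contra h
  obtain ⟨e', -, hne, h'⟩ := exists_ne_of_mem_toricIdeal hf (MvPolynomial.mem_support_iff.2 h)
  exact hne (he e' h')

theorem degree_multidegree {u : ι → (σ →₀ ℕ)} {r : ℕ} (hu : ∀ i, (u i).degree = r)
    (e : ι →₀ ℕ) : (multidegree u e).degree = e.degree * r := by
  induction e using Finsupp.induction_linear with
  | zero => simp
  | add f g hf hg => rw [map_add, map_add, hf, hg, map_add, add_mul]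
  | single i n =>
    rw [← mul_one n, ← smul_eq_mul, ← Finsupp.smul_single, map_smul, multidegree_single]
    rw [map_nsmul, map_nsmul, hu, Finsupp.degree_single]
    simp

/-- The toric ideal of monomials of a common positive degree is homogeneous. -/
theorem homogeneousComponent_mem_toricIdeal {u : ι → (σ →₀ ℕ)} {r : ℕ} (hr : 0 < r)
    (hu : ∀ i, (u i).degree = r) {f : MvPolynomial ι K} (hf : f ∈ toricIdeal K u) (d : ℕ) :
    MvPolynomial.homogeneousComponent d f ∈ toricIdeal K u := by
  classical
  rw [mem_toricIdeal_iff] at hf ⊢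
  intro w
  have hdeg : ∀ e, multidegree u e = w → e.degree * r = w.degree := by
    rintro e rfl; exact (degree_multidegree hu e).symm
  by_cases hw : w.degree = d * r
  · rw [← hf w]
    have : (MvPolynomial.homogeneousComponent d f).support.filter (fun e => multidegree u e = w)
        = f.support.filter (fun e => multidegree u e = w) := by
      ext e
      simp only [Finset.mem_filter, MvPolynomial.mem_support_iff,
        MvPolynomial.coeff_homogeneousComponent]
      refine and_congr_left fun he => ?_
      rw [if_pos (Nat.eq_of_mul_eq_mul_right hr ((hdeg e he).trans hw))]
    rw [this]
    refine Finset.sum_congr rfl fun e he => ?_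
    rw [MvPolynomial.coeff_homogeneousComponent,
      if_pos (Nat.eq_of_mul_eq_mul_right hr ((hdeg e (Finset.mem_filter.1 he).2).trans hw))]
  · refine Finset.sum_eq_zero fun e he => ?_
    rw [MvPolynomial.coeff_homogeneousComponent, if_neg]
    rintro rfl
    exact hw (hdeg e (Finset.mem_filter.1 he).2).symm

/-! ### Reduction by binomials -/

/-- A monomial is reduced with respect to a set of rewriting rules `T^a → T^b` if it is divisible
by no left-hand side. -/
def IsReducedMonomial (Q : Set ((ι →₀ ℕ) × (ι →₀ ℕ))) (e : ι →₀ ℕ) : Prop :=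
  ∀ q ∈ Q, ¬ q.1 ≤ e

/-- The binomials `T^a - T^b` of a set of rewriting rules `T^a → T^b`. -/
def binomials (K : Type*) [Field K] (Q : Set ((ι →₀ ℕ) × (ι →₀ ℕ))) : Set (MvPolynomial ι K) :=
  (fun q => MvPolynomial.monomial q.1 1 - MvPolynomial.monomial q.2 1) '' Q

theorem exists_reduced_of_decreasing {W : Type*} [Preorder W] [WellFoundedLT W]
    {u : ι → (σ →₀ ℕ)} {Q : Set ((ι →₀ ℕ) × (ι →₀ ℕ))} (μ : (ι →₀ ℕ) → W)
    (hQ : ∀ q ∈ Q, multidegree u q.1 = multidegree u q.2)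
    (hμ : ∀ q ∈ Q, ∀ c, μ (c + q.2) < μ (c + q.1)) (e : ι →₀ ℕ) :
    ∃ e', IsReducedMonomial Q e' ∧ multidegree u e' = multidegree u e ∧
      (MvPolynomial.monomial e 1 - MvPolynomial.monomial e' 1 : MvPolynomial ι K)
        ∈ Ideal.span (binomials K Q) := by
  induction h : μ e using WellFoundedLT.induction generalizing e with
  | ind w ih =>
    subst h
    by_cases he : IsReducedMonomial Q e
    · exact ⟨e, he, rfl, by simp⟩
    · simp only [IsReducedMonomial, not_forall, not_not] at he
      obtain ⟨q, hq, hle⟩ := he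
      obtain ⟨c, rfl⟩ := exists_add_of_le hle
      rw [add_comm q.1 c] at ih ⊢
      obtain ⟨e', h1, h2, h3⟩ := ih _ (hμ q hq c) _ rfl
      refine ⟨e', h1, ?_, ?_⟩
      · rw [h2, map_add, map_add, hQ q hq]
      · have h4 : (MvPolynomial.monomial (c + q.1) 1 - MvPolynomial.monomial (c + q.2) 1 :
            MvPolynomial ι K) ∈ Ideal.span (binomials K Q) := by
          have := Ideal.mul_mem_left (Ideal.span (binomials K Q)) (MvPolynomial.monomial c 1)
            (Ideal.subset_span ⟨q, hq, rfl⟩)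
          simpa [mul_sub, MvPolynomial.monomial_mul] using this
        have h5 := Ideal.add_mem _ h4 h3
        rwa [sub_add_sub_cancel] at h5

/-- If rewriting terminates and each fibre contains at most one reduced monomial, then the
binomials of the rewriting rules generate the toric ideal. -/
theorem toricIdeal_eq_span_binomials {W : Type*} [Preorder W] [WellFoundedLT W]
    {u : ι → (σ →₀ ℕ)} {Q : Set ((ι →₀ ℕ) × (ι →₀ ℕ))} (μ : (ι →₀ ℕ) → W)
    (hQ : ∀ q ∈ Q, multidegree u q.1 = multidegree u q.2)
    (hμ : ∀ q ∈ Q, ∀ c, μ (c + q.2) < μ (c + q.1))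
    (huniq : ∀ e e', IsReducedMonomial Q e → IsReducedMonomial Q e' →
      multidegree u e = multidegree u e' → e = e') :
    toricIdeal K u = Ideal.span (binomials K Q) := by
  classical
  apply le_antisymm
  · intro f hf
    choose s hs1 hs2 hs3 using exists_reduced_of_decreasing (K := K) μ hQ hμ
    have key : ∑ e ∈ f.support, MvPolynomial.monomial (s e) (f.coeff e) = 0 := by
      ext e₁
      rw [MvPolynomial.coeff_sum]
      simp_rw [MvPolynomial.coeff_monomial]
      rw [← Finset.sum_filter, MvPolynomial.coeff_zero]
      by_cases hex : ∃ e, s e = e₁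
      · obtain ⟨e₀, rfl⟩ := hex
        rw [← mem_toricIdeal_iff.1 hf (multidegree u e₀)]
        refine Finset.sum_congr (Finset.filter_congr fun e _ => ?_) fun _ _ => rfl
        constructor
        · intro h; rw [← hs2 e, h, hs2]
        · intro h; exact huniq _ _ (hs1 e) (hs1 e₀) (by rw [hs2, hs2, h])
      · push Not at hex
        exact Finset.sum_eq_zero fun e he => absurd (Finset.mem_filter.1 he).2 (hex e)
    have h2 : f = ∑ e ∈ f.support, MvPolynomial.C (f.coeff e) *
        (MvPolynomial.monomial e 1 - MvPolynomial.monomial (s e) 1) := by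
      simp_rw [mul_sub, MvPolynomial.C_mul_monomial, mul_one]
      rw [Finset.sum_sub_distrib, key, sub_zero]
      exact f.as_sum
    rw [h2]
    exact Ideal.sum_mem _ fun e _ => Ideal.mul_mem_left _ _ (hs3 e)
  · rw [Ideal.span_le]
    rintro _ ⟨q, hq, rfl⟩
    exact monomial_sub_monomial_mem_toricIdeal (hQ q hq)

/-- If the rewriting rules decrease the monomial order and each fibre contains at most one reduced
monomial, then the binomials form a Gröbner basis. The reduced monomial of a fibre is its minimum,
whereas the leading monomial of an element of the toric ideal is not the minimum of its fibre. -/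
theorem isGroebnerBasis_binomials (o : MonomialOrder ι)
    {u : ι → (σ →₀ ℕ)} {Q : Set ((ι →₀ ℕ) × (ι →₀ ℕ))} (hfin : Q.Finite)
    (hQ : ∀ q ∈ Q, multidegree u q.1 = multidegree u q.2)
    (hlt : ∀ q ∈ Q, o.toSyn q.2 < o.toSyn q.1)
    (huniq : ∀ e e', IsReducedMonomial Q e → IsReducedMonomial Q e' →
      multidegree u e = multidegree u e' → e = e') :
    IsGroebnerBasis o (binomials K Q) (toricIdeal K u) := by
  classical
  have hsub : binomials K Q ⊆ toricIdeal K u := by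
    rintro _ ⟨q, hq, rfl⟩
    exact monomial_sub_monomial_mem_toricIdeal (hQ q hq)
  refine ⟨hfin.image _, hsub, ?_⟩
  apply le_antisymm
  · apply Ideal.span_mono
    rintro t ⟨f, hf, h⟩
    exact ⟨f, hsub hf, h⟩
  · rw [initialIdeal, Ideal.span_le]
    rintro _ ⟨f, hf, hf0, rfl⟩
    have hex : ∃ q ∈ Q, q.1 ≤ o.degree f := by
      by_contra! hred
      obtain ⟨e', he', hne, hmd⟩ := exists_ne_of_mem_toricIdeal hf (o.degree_mem_support hf0)
      have hlt' : o.toSyn e' < o.toSyn (o.degree f) :=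
        lt_of_le_of_ne (o.le_degree he') (fun h => hne (o.toSyn.injective h))
      obtain ⟨e'', ⟨hmem, hmin⟩⟩ := WellFounded.has_min (r := fun a b => o.toSyn a < o.toSyn b)
        (InvImage.wf _ wellFounded_lt) {e | multidegree u e = multidegree u (o.degree f)} ⟨_, rfl⟩
      have hred'' : IsReducedMonomial Q e'' := by
        intro q hq hle
        obtain ⟨c, rfl⟩ := exists_add_of_le hle
        refine hmin (q.2 + c) ?_ ?_
        · change _ = _
          rw [map_add, ← hQ q hq, ← map_add]; exact hmem
        · rw [map_add, map_add]
          exact add_lt_add_left (hlt q hq) _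
      rw [huniq _ _ hred'' hred hmem] at hmin
      exact hmin e' hmd hlt'
    obtain ⟨q, hq, hle⟩ := hex
    obtain ⟨c, hc⟩ := exists_add_of_le hle
    rw [hc, add_comm, ← one_mul (1 : K), ← MvPolynomial.monomial_mul]
    refine Ideal.mul_mem_left _ _ (Ideal.subset_span ⟨_, ⟨q, hq, rfl⟩, ?_⟩)
    have hd : o.degree (MvPolynomial.monomial q.1 1 - MvPolynomial.monomial q.2 1 :
        MvPolynomial ι K) = q.1 := by
      rw [o.degree_sub_of_lt, o.degree_monomial, if_neg one_ne_zero]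
      rw [o.degree_monomial, o.degree_monomial, if_neg one_ne_zero, if_neg one_ne_zero]
      exact hlt q hq
    refine ⟨fun h0 => ?_, by rw [hd]⟩
    have := MvPolynomial.monomial_left_injective (one_ne_zero (α := K)) (sub_eq_zero.1 h0)
    exact (hlt q hq).ne (by rw [← this])

/-! ### Fibres that obstruct quadratic generation -/

/-- `e` and `o` are monomials of degree three without common factor that make up a whole fibre of
the multidegree. The binomial `T^e - T^o` is then a minimal generator of the toric ideal. -/
structure IsCubicFibre (u : ι → (σ →₀ ℕ)) (e o : ι →₀ ℕ) : Prop where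
  degree_left : e.degree = 3
  degree_right : o.degree = 3
  disjoint : ∀ i, e i = 0 ∨ o i = 0
  multidegree_eq : multidegree u e = multidegree u o
  eq_or_eq : ∀ e', multidegree u e' = multidegree u e → e' = e ∨ e' = o

namespace IsCubicFibre

variable {u : ι → (σ →₀ ℕ)} {e o : ι →₀ ℕ}

theorem symm (h : IsCubicFibre u e o) : IsCubicFibre u o e :=
  ⟨h.degree_right, h.degree_left, fun i => (h.disjoint i).symm, h.multidegree_eq.symm,
    fun e' he' => (h.eq_or_eq e' (he'.trans h.multidegree_eq.symm)).symm⟩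

/-- A quadratic factor of one of the two monomials is alone in its fibre. -/
theorem eq_of_le (h : IsCubicFibre u e o) {b b' : ι →₀ ℕ} (hb : b ≤ e) (hdeg : b.degree = 2)
    (hbb' : multidegree u b' = multidegree u b) : b' = b := by
  obtain ⟨c, rfl⟩ := exists_add_of_le hb
  have hc : c ≠ 0 := by
    rintro rfl
    have := h.degree_left
    rw [add_zero] at this
    omega
  obtain ⟨i, hi⟩ := Finsupp.ne_iff.1 hc
  rcases h.eq_or_eq (b' + c) (by rw [map_add, map_add, hbb']) with h1 | h1
  · exact add_right_cancel h1
  · exfalso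
    have h2 := DFunLike.congr_fun h1 i
    have h3 := h.disjoint i
    simp only [Finsupp.add_apply, Finsupp.coe_zero, Pi.zero_apply] at h2 h3 hi
    omega

theorem ne (h : IsCubicFibre u e o) : e ≠ o := by
  rintro rfl
  have h1 : e = 0 := by ext i; simpa using h.disjoint i
  have := h.degree_left
  simp [h1] at this

theorem coeff_eq_zero (h : IsCubicFibre u e o) {q : MvPolynomial ι K} (hq : q ∈ toricIdeal K u)
    (hq2 : q.IsHomogeneous 2) {b : ι →₀ ℕ} (hb : b ≤ e) : q.coeff b = 0 := by
  by_cases hdeg : b.degree = 2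
  · exact coeff_eq_zero_of_mem_toricIdeal hq fun b' hb' => h.eq_of_le hb hdeg hb'
  · exact hq2.coeff_eq_zero hdeg

theorem not_isQuadraticallyGenerated (h : IsCubicFibre u e o) :
    ¬ IsQuadraticallyGenerated (toricIdeal K u) := by
  classical
  rintro ⟨G, hG, hI⟩
  have key : ∀ f ∈ toricIdeal K u, ∀ b ≤ e, f.coeff b = 0 := by
    intro f hf
    rw [hI] at hf
    induction hf using Submodule.span_induction with
    | mem x hx => exact fun b hb => h.coeff_eq_zero (hI ▸ Ideal.subset_span hx) (hG x hx) hb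
    | zero => simp
    | add x y _ _ hx hy =>
      intro b hb
      rw [MvPolynomial.coeff_add, hx b hb, hy b hb, add_zero]
    | smul a x _ hx =>
      intro b hb
      rw [smul_eq_mul, MvPolynomial.coeff_mul]
      refine Finset.sum_eq_zero fun p hp => ?_
      rw [Finset.HasAntidiagonal.mem_antidiagonal] at hp
      rw [hx p.2 ((le_of_le_of_eq le_add_self hp).trans hb), mul_zero]
  have h1 := key _ (monomial_sub_monomial_mem_toricIdeal h.multidegree_eq) e le_rfl
  rw [MvPolynomial.coeff_sub, MvPolynomial.coeff_monomial, MvPolynomial.coeff_monomial,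
    if_pos rfl, if_neg h.ne.symm] at h1
  simp at h1

theorem not_hasQuadraticGroebnerBasis (h : IsCubicFibre u e o) (m : MonomialOrder ι) :
    ¬ HasQuadraticGroebnerBasis m (toricIdeal K u) := by
  classical
  rintro ⟨G, hG, -, hsub, hin⟩
  set f : MvPolynomial ι K := MvPolynomial.monomial e 1 - MvPolynomial.monomial o 1 with hf
  have hfI : f ∈ toricIdeal K u := monomial_sub_monomial_mem_toricIdeal h.multidegree_eq
  have hf0 : f ≠ 0 := fun h0 =>
    h.ne (MvPolynomial.monomial_left_injective (one_ne_zero (α := K)) (sub_eq_zero.1 h0))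
  have hmem : MvPolynomial.monomial (m.degree f) (1 : K) ∈ initialIdeal m G := by
    rw [hin]
    exact Ideal.subset_span ⟨f, hfI, hf0, rfl⟩
  have hset : {t | ∃ f ∈ G, f ≠ 0 ∧ t = MvPolynomial.monomial (m.degree f) (1 : K)}
      = (fun s => MvPolynomial.monomial s (1 : K)) '' {s | ∃ g ∈ G, g ≠ 0 ∧ s = m.degree g} := by
    ext t
    constructor
    · rintro ⟨g, hg, hg0, rfl⟩
      exact ⟨_, ⟨g, hg, hg0, rfl⟩, rfl⟩
    · rintro ⟨_, ⟨g, hg, hg0, rfl⟩, rfl⟩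
      exact ⟨g, hg, hg0, rfl⟩
  rw [initialIdeal, hset, MvPolynomial.mem_ideal_span_monomial_image] at hmem
  obtain ⟨_, ⟨g, hg, hg0, rfl⟩, hle⟩ := hmem (m.degree f) (by
    rw [MvPolynomial.mem_support_iff, MvPolynomial.coeff_monomial, if_pos rfl]
    exact one_ne_zero)
  refine m.coeff_degree_ne_zero_iff.2 hg0 ?_
  have hd : m.degree f = e ∨ m.degree f = o := by
    have := m.degree_mem_support hf0
    rw [MvPolynomial.mem_support_iff, hf, MvPolynomial.coeff_sub, MvPolynomial.coeff_monomial,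
      MvPolynomial.coeff_monomial] at this
    by_contra! hcon
    rw [if_neg (Ne.symm hcon.1), if_neg (Ne.symm hcon.2)] at this
    simp at this
  rcases hd with hd | hd
  · exact h.coeff_eq_zero (hsub hg) (hG g hg) (hd ▸ hle)
  · exact h.symm.coeff_eq_zero (hsub hg) (hG g hg) (hd ▸ hle)

end IsCubicFibre

end Toric

/-! ### Posets of width at most two -/

section Width

theorem exists_antichain_of_not_posetWidth_le_two {P : Type*} [PartialOrder P]
    (h : ¬ posetWidth P ≤ 2) :
    ∃ p : Fin 3 → P, ∀ i j, i ≠ j → ¬ p i ≤ p j := by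
  rw [posetWidth, iSup_le_iff, not_forall] at h
  obtain ⟨⟨s, hs⟩, hcard⟩ := h
  simp only [not_le] at hcard
  obtain ⟨t, hts, htc⟩ := Set.exists_subset_encard_eq
    (show (3 : ℕ∞) ≤ s.encard from Order.add_one_le_of_lt hcard)
  obtain ⟨x, y, z, hxy, hxz, hyz, rfl⟩ := Set.encard_eq_three.1 htc
  have hx : x ∈ s := hts (by simp)
  have hy : y ∈ s := hts (by simp)
  have hz : z ∈ s := hts (by simp)
  refine ⟨![x, y, z], fun i j hij => ?_⟩
  fin_cases i <;> fin_cases j <;>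
    first
    | exact absurd rfl hij
    | exact hs hx hy hxy
    | exact hs hx hz hxz
    | exact hs hy hz hyz
    | exact hs hy hx hxy.symm
    | exact hs hz hx hxz.symm
    | exact hs hz hy hyz.symm

/-- Dilworth's theorem for width two, for a finite subset of a poset. The step removes a maximal
element `a`: in a chain cover `A`, `B` of the rest, the largest `x ∈ A` and `y ∈ B` that belong to
incomparable pairs are themselves incomparable, so `a` lies above one of them. -/
theorem exists_two_chains {P : Type*} [PartialOrder P] (s : Finset P)
    (h : ∀ x ∈ s, ∀ y ∈ s, ∀ z ∈ s, x ≤ y ∨ y ≤ x ∨ x ≤ z ∨ z ≤ x ∨ y ≤ z ∨ z ≤ y) :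
    ∃ A B : Set P, IsChain (· ≤ ·) A ∧ IsChain (· ≤ ·) B ∧ Disjoint A B ∧ A ∪ B = s := by
  classical
  induction hn : s.card generalizing s with
  | zero =>
    rw [Finset.card_eq_zero] at hn
    exact ⟨∅, ∅, by simp [hn]⟩
  | succ n ih =>
    have hne : s.Nonempty := Finset.card_pos.1 (by omega)
    obtain ⟨a, has, hmax⟩ := s.exists_maximal hne
    have hmax' : ∀ x ∈ s, a ≤ x → x = a := fun x hx hax => le_antisymm (hmax hx hax) hax
    obtain ⟨A, B, hA, hB, hd, hAB⟩ := ih (s.erase a)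
      (fun x hx y hy z hz => h x (Finset.mem_of_mem_erase hx) y (Finset.mem_of_mem_erase hy) z
        (Finset.mem_of_mem_erase hz)) (by rw [Finset.card_erase_of_mem has]; omega)
    have hAs : ∀ x ∈ A, x ∈ s ∧ x ≠ a := fun x hx => by
      have : x ∈ (↑(s.erase a) : Set P) := hAB ▸ Or.inl hx
      simpa [and_comm] using this
    have hBs : ∀ x ∈ B, x ∈ s ∧ x ≠ a := fun x hx => by
      have : x ∈ (↑(s.erase a) : Set P) := hAB ▸ Or.inr hx
      simpa [and_comm] using this
    have hcov : ∀ x, x ∈ s ↔ x = a ∨ x ∈ A ∨ x ∈ B := by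
      intro x
      have : x ∈ A ∪ B ↔ x ∈ (↑(s.erase a) : Set P) := by rw [hAB]
      simp only [Set.mem_union, Finset.coe_erase, Set.mem_sdiff, Finset.mem_coe,
        Set.mem_singleton_iff] at this
      constructor
      · intro hx
        by_cases hxa : x = a
        · exact Or.inl hxa
        · exact Or.inr (this.2 ⟨hx, hxa⟩)
      · rintro (rfl | hx)
        · exact has
        · exact (this.1 hx).1
    -- The core of the step, symmetric in `A` and `B`.
    have core : ∀ A B : Set P, IsChain (· ≤ ·) A → IsChain (· ≤ ·) B → Disjoint A B →
        (∀ x ∈ A, x ∈ s ∧ x ≠ a) → (∀ x ∈ B, x ∈ s ∧ x ≠ a) →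
        (∀ x, x ∈ s ↔ x = a ∨ x ∈ A ∨ x ∈ B) → ∀ x, x ≤ a →
        (∀ z ∈ A, ∀ w ∈ B, ¬ z ≤ w → ¬ w ≤ z → z ≤ x) →
        ∃ A B : Set P, IsChain (· ≤ ·) A ∧ IsChain (· ≤ ·) B ∧ Disjoint A B ∧ A ∪ B = s := by
      intro A B hA hB hd hAs hBs hcov x hxa hx
      refine ⟨{z | z = a ∨ z ∈ A ∧ z ≤ x}, {z | z ∈ B ∨ z ∈ A ∧ ¬ z ≤ x}, ?_, ?_, ?_, ?_⟩
      · rintro z (rfl | ⟨hz, hzx⟩) w (rfl | ⟨hw, hwx⟩) hzw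
        · exact absurd rfl hzw
        · exact Or.inr (hwx.trans hxa)
        · exact Or.inl (hzx.trans hxa)
        · exact hA hz hw hzw
      · rintro z (hz | ⟨hz, hzx⟩) w (hw | ⟨hw, hwx⟩) hzw
        · exact hB hz hw hzw
        · by_contra hcon
          simp only [not_or] at hcon
          exact hwx (hx w hw z hz hcon.2 hcon.1)
        · by_contra hcon
          simp only [not_or] at hcon
          exact hzx (hx z hz w hw hcon.1 hcon.2)
        · exact hA hz hw hzw
      · rw [Set.disjoint_left]
        rintro z (rfl | ⟨hz, hzx⟩) (hw | ⟨hw, hwx⟩)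
        · exact (hBs _ hw).2 rfl
        · exact (hAs _ hw).2 rfl
        · exact Set.disjoint_left.1 hd hz hw
        · exact hwx hzx
      · ext z
        simp only [Set.mem_union, Set.mem_ofPred_eq, Finset.mem_coe, hcov]
        tauto
    by_cases hpair : ∃ z ∈ A, ∃ w ∈ B, ¬ z ≤ w ∧ ¬ w ≤ z
    · obtain ⟨z₀, hz₀, w₀, hw₀, h₀⟩ := hpair
      have hmaxof : ∀ (C : Set P) (p : P → Prop), IsChain (· ≤ ·) C → (∀ x ∈ C, x ∈ s) →
          (∃ x ∈ C, p x) → ∃ x ∈ C, p x ∧ ∀ z ∈ C, p z → z ≤ x := by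
        rintro C p hC hCs ⟨x₀, hx₀, hp₀⟩
        obtain ⟨x, hx, hxm⟩ := (s.filter fun z => z ∈ C ∧ p z).exists_maximal
          ⟨x₀, by simp [hCs x₀ hx₀, hx₀, hp₀]⟩
        simp only [Finset.mem_filter] at hx
        refine ⟨x, hx.2.1, hx.2.2, fun z hz hpz => ?_⟩
        rcases hC.total hz hx.2.1 with hle | hle
        · exact hle
        · exact hxm (Finset.mem_filter.2 ⟨hCs z hz, hz, hpz⟩) hle
      obtain ⟨x, hxA, ⟨y', hy', hxy'⟩, hxm⟩ := hmaxof A (fun z => ∃ w ∈ B, ¬ z ≤ w ∧ ¬ w ≤ z)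
        hA (fun x hx => (hAs x hx).1) ⟨z₀, hz₀, w₀, hw₀, h₀⟩
      obtain ⟨y, hyB, ⟨x', hx', hxy''⟩, hym⟩ := hmaxof B (fun w => ∃ z ∈ A, ¬ z ≤ w ∧ ¬ w ≤ z)
        hB (fun x hx => (hBs x hx).1) ⟨w₀, hw₀, z₀, hz₀, h₀⟩
      have hx'x : x' ≤ x := hxm x' hx' ⟨y, hyB, hxy''⟩
      have hy'y : y' ≤ y := hym y' hy' ⟨x, hxA, hxy'⟩
      have hxa : x ≤ a ∨ y ≤ a := by
        have h1 : ¬ x ≤ y := fun hle => hxy''.1 (hx'x.trans hle)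
        have h2 : ¬ y ≤ x := fun hle => hxy'.2 (hy'y.trans hle)
        rcases h x (hAs x hxA).1 y (hBs y hyB).1 a has with h3 | h3 | h3 | h3 | h3 | h3
        · exact absurd h3 h1
        · exact absurd h3 h2
        · exact Or.inl h3
        · exact absurd (hmax' x (hAs x hxA).1 h3) (hAs x hxA).2
        · exact Or.inr h3
        · exact absurd (hmax' y (hBs y hyB).1 h3) (hBs y hyB).2
      rcases hxa with hxa | hya
      · exact core A B hA hB hd hAs hBs hcov x hxa
          fun z hz w hw h1 h2 => hxm z hz ⟨w, hw, h1, h2⟩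
      · exact core B A hB hA hd.symm hBs hAs (fun x => by rw [hcov]; tauto) y hya
          fun z hz w hw h1 h2 => hym z hz ⟨w, hw, h2, h1⟩
    · push Not at hpair
      refine ⟨{a}, A ∪ B, IsChain.singleton, ?_, ?_, ?_⟩
      · rintro z (hz | hz) w (hw | hw) hzw
        · exact hA hz hw hzw
        · by_cases hle : z ≤ w
          · exact Or.inl hle
          · exact Or.inr (hpair z hz w hw hle)
        · by_cases hle : w ≤ z
          · exact Or.inr hle
          · exact Or.inl (hpair w hw z hz hle)
        · exact hB hz hw hzw
      · rw [Set.disjoint_left]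
        rintro z rfl (hz | hz)
        · exact (hAs _ hz).2 rfl
        · exact (hBs _ hz).2 rfl
      · ext z
        simp only [Set.mem_union, Set.mem_singleton_iff, Finset.mem_coe, hcov]

theorem exists_isChainCover {L : Type*} [DistribLattice L] [Finite L] (h : IsPlanarLattice L) :
    ∃ A B : Set (JoinIrr L), IsChainCover A B := by
  classical
  have := Fintype.ofFinite (JoinIrr L)
  obtain ⟨A, B, hA, hB, hd, hAB⟩ := exists_two_chains (Finset.univ : Finset (JoinIrr L)) (by
    intro x _ y _ z _
    by_contra! hcon
    obtain ⟨h1, h2, h3, h4, h5, h6⟩ := hcon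
    have hanti : IsAntichain (· ≤ ·) ({x, y, z} : Set (JoinIrr L)) := by
      rintro p (rfl | rfl | rfl) q (rfl | rfl | rfl) hpq <;>
        first
        | exact absurd rfl hpq
        | assumption
    have hw : ({x, y, z} : Set (JoinIrr L)).encard ≤ 2 :=
      (le_iSup (fun s : {s : Set (JoinIrr L) // IsAntichain (· ≤ ·) s} => s.1.encard)
        ⟨_, hanti⟩).trans h
    rw [Set.encard_eq_three.2 ⟨x, y, z, fun h => h1 h.le, fun h => h3 h.le, fun h => h5 h.le, rfl⟩]
      at hw
    exact absurd hw (by decide))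
  exact ⟨A, B, hA, hB, hd, by rw [hAB, Finset.coe_univ]⟩

end Width

/-! ### Rank and maximal chains in a finite distributive lattice -/

section Rank

variable {L : Type*} [DistribLattice L] [BoundedOrder L] [Finite L]

theorem le_iff_forall_joinIrr {x y : L} : x ≤ y ↔ ∀ p : JoinIrr L, p.1 ≤ x → p.1 ≤ y := by
  refine ⟨fun h p hp => hp.trans h, fun h => ?_⟩
  obtain ⟨s, hs, hirr⟩ := exists_supIrred_decomposition x
  rw [← hs, Finset.sup_le_iff]
  intro b hb
  refine h ⟨b, hirr hb⟩ ?_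
  rw [← hs]
  exact Finset.le_sup (f := id) hb

omit [BoundedOrder L] [Finite L] in
theorem joinIrr_le_sup (p : JoinIrr L) {x y : L} : p.1 ≤ x ⊔ y ↔ p.1 ≤ x ∨ p.1 ≤ y :=
  p.2.supPrime.le_sup

/-- The rank of an element: the number of join-irreducible elements below it. -/
noncomputable def rk (x : L) : ℕ := {p : JoinIrr L | p.1 ≤ x}.ncard

theorem rk_strictMono : StrictMono (rk : L → ℕ) := by
  intro x y hxy
  refine Set.ncard_lt_ncard ⟨fun p (hp : p.1 ≤ x) => hp.trans hxy.le, fun h => ?_⟩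
  exact hxy.not_ge (le_iff_forall_joinIrr.2 fun p hp => h hp)

theorem rk_bot : rk (⊥ : L) = 0 := by
  rw [rk, Set.ncard_eq_zero]
  ext p
  simpa using p.2.ne_bot

theorem rk_eq_zero {x : L} : rk x = 0 ↔ x = ⊥ := by
  refine ⟨fun h => ?_, fun h => h ▸ rk_bot⟩
  by_contra hx
  have := rk_strictMono (bot_lt_iff_ne_bot.2 hx)
  omega

theorem rk_eq_rk_top {x : L} : rk x = rk (⊤ : L) ↔ x = ⊤ := by
  refine ⟨fun h => ?_, fun h => h ▸ rfl⟩
  by_contra hx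
  have := rk_strictMono (lt_top_iff_ne_top.2 hx)
  omega

theorem rk_le_rk_top (x : L) : rk x ≤ rk (⊤ : L) := rk_strictMono.monotone le_top

theorem interior_iff {x : L} : (x ≠ ⊥ ∧ x ≠ ⊤) ↔ 0 < rk x ∧ rk x < rk (⊤ : L) := by
  rw [Nat.pos_iff_ne_zero, Ne, Ne, Ne, rk_eq_zero, (rk_le_rk_top x).lt_iff_ne, Ne, rk_eq_rk_top]

theorem two_le_rk_top (hL : 3 ≤ Nat.card L) : 2 ≤ rk (⊤ : L) := by
  by_contra hlt
  have hsub : (Set.univ : Set L) ⊆ {⊥, ⊤} := by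
    intro x _
    by_contra hx
    have hx' : x ≠ ⊥ ∧ x ≠ ⊤ := by simpa using hx
    rw [interior_iff] at hx'
    omega
  have h1 := Set.ncard_le_ncard hsub
  rw [Set.ncard_univ] at h1
  have h2 := Set.ncard_insert_le (⊥ : L) {⊤}
  rw [Set.ncard_singleton] at h2
  omega

theorem rk_of_covBy {x y : L} (h : x ⋖ y) : rk y = rk x + 1 := by
  have hex : ∃ p : JoinIrr L, p.1 ≤ y ∧ ¬ p.1 ≤ x := by
    by_contra! hcon
    exact h.lt.not_ge (le_iff_forall_joinIrr.2 hcon)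
  obtain ⟨p, hpy, hpx⟩ := hex
  have hsup : ∀ q : JoinIrr L, q.1 ≤ y → ¬ q.1 ≤ x → x ⊔ q.1 = y := by
    intro q hq hqx
    rcases h.eq_or_eq (le_sup_left : x ≤ x ⊔ q.1) (sup_le h.le hq) with h1 | h1
    · exact absurd (sup_eq_left.1 h1) hqx
    · exact h1
  have hset : {q : JoinIrr L | q.1 ≤ y} = insert p {q : JoinIrr L | q.1 ≤ x} := by
    ext q
    constructor
    · intro (hq : q.1 ≤ y)
      by_cases hqx : q.1 ≤ x
      · exact Or.inr hqx
      · left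
        apply Subtype.ext
        apply le_antisymm
        · exact ((joinIrr_le_sup q).1 (hq.trans (hsup p hpy hpx).ge)).resolve_left hqx
        · exact ((joinIrr_le_sup p).1 (hpy.trans (hsup q hq hqx).ge)).resolve_left hpx
    · rintro (rfl | hq)
      · exact hpy
      · exact (show q.1 ≤ x from hq).trans h.le
  have hp : p ∉ {q : JoinIrr L | q.1 ≤ x} := hpx
  rw [rk, hset, Set.ncard_insert_of_notMem hp, rk]

namespace MaxChain

theorem exists_mem_rk_eq (C : MaxChain L) {k : ℕ} (hk : k ≤ rk (⊤ : L)) :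
    ∃ c ∈ C.1, rk c = k := by
  induction k with
  | zero => exact ⟨⊥, C.2.bot_mem, rk_bot⟩
  | succ k ih =>
    obtain ⟨c, hc, rfl⟩ := ih (by omega)
    have hctop : c < ⊤ := lt_top_iff_ne_top.2 fun h => by rw [h] at hk; omega
    obtain ⟨d, ⟨hdC, hcd⟩, hmin⟩ := Set.Finite.exists_minimal
      (Set.toFinite {d | d ∈ C.1 ∧ c < d}) ⟨⊤, C.2.top_mem, hctop⟩
    refine ⟨d, hdC, rk_of_covBy ⟨hcd, fun e hce hed => ?_⟩⟩
    have hchain : IsChain (· ≤ ·) (insert e C.1) := by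
      refine C.2.isChain.insert fun x hx _ => ?_
      rcases C.2.isChain.total hx hc with hxc | hcx
      · exact Or.inr (hxc.trans hce.le)
      · rcases hcx.eq_or_lt with rfl | hcx
        · exact Or.inr hce.le
        · rcases C.2.isChain.total hx hdC with hxd | hdx
          · exact Or.inl (hed.le.trans (hmin ⟨hx, hcx⟩ hxd))
          · exact Or.inl (hed.le.trans hdx)
    have heC : e ∈ C.1 := by
      rw [C.2.2 hchain (Set.subset_insert _ _)]
      exact Set.mem_insert _ _
    exact hed.not_ge (hmin ⟨heC, hce⟩ hed.le)

/-- The element of rank `k` of a maximal chain (with the value `⊤` if `k` exceeds all ranks). -/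
noncomputable def el (C : MaxChain L) (k : ℕ) : L :=
  if h : k ≤ rk (⊤ : L) then (C.exists_mem_rk_eq h).choose else ⊤

variable (C : MaxChain L)

theorem el_mem (k : ℕ) : C.el k ∈ C.1 := by
  rw [el]
  split_ifs with h
  · exact (C.exists_mem_rk_eq h).choose_spec.1
  · exact C.2.top_mem

theorem rk_el {k : ℕ} (hk : k ≤ rk (⊤ : L)) : rk (C.el k) = k := by
  rw [el, dif_pos hk]
  exact (C.exists_mem_rk_eq hk).choose_spec.2

variable {C}

theorem eq_of_rk_eq {x y : L} (hx : x ∈ C.1) (hy : y ∈ C.1) (h : rk x = rk y) : x = y := by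
  by_contra hne
  rcases C.2.isChain hx hy hne with hle | hle
  · exact (rk_strictMono (lt_of_le_of_ne hle hne)).ne h
  · exact (rk_strictMono (lt_of_le_of_ne hle (Ne.symm hne))).ne h.symm

theorem le_of_rk_le {x y : L} (hx : x ∈ C.1) (hy : y ∈ C.1) (h : rk x ≤ rk y) : x ≤ y := by
  rcases C.2.isChain.total hx hy with hle | hle
  · exact hle
  · exact (eq_of_rk_eq hx hy (le_antisymm h (rk_strictMono.monotone hle))).le

theorem el_rk {x : L} (hx : x ∈ C.1) : C.el (rk x) = x :=
  eq_of_rk_eq (C.el_mem _) hx (C.rk_el (rk_le_rk_top x))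

theorem mem_iff {x : L} : x ∈ C.1 ↔ C.el (rk x) = x :=
  ⟨el_rk, fun h => h ▸ C.el_mem _⟩

theorem el_mono {j k : ℕ} (hjk : j ≤ k) (hk : k ≤ rk (⊤ : L)) : C.el j ≤ C.el k :=
  le_of_rk_le (C.el_mem _) (C.el_mem _) (by rw [C.rk_el hk, C.rk_el (hjk.trans hk)]; exact hjk)

omit [BoundedOrder L] [Finite L] in
theorem ext_of_subset {D : MaxChain L} (h : C.1 ⊆ D.1) : C = D :=
  Subtype.ext (C.2.2 D.2.isChain h)

theorem ext_el {D : MaxChain L} (h : ∀ k, 0 < k → k < rk (⊤ : L) → C.el k = D.el k) : C = D := by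
  refine ext_of_subset fun x hx => ?_
  by_cases hint : x ≠ ⊥ ∧ x ≠ ⊤
  · rw [interior_iff] at hint
    rw [mem_iff, ← h _ hint.1 hint.2]
    exact el_rk hx
  · rw [not_and_or, not_not, not_not] at hint
    rcases hint with rfl | rfl
    · exact D.2.bot_mem
    · exact D.2.top_mem

/-- A chain that meets every rank is a maximal chain. -/
def ofRanks (s : Set L) (hs : IsChain (· ≤ ·) s)
    (h : ∀ k ≤ rk (⊤ : L), ∃ c ∈ s, rk c = k) : MaxChain L :=
  ⟨s, hs, fun t ht hst => by
    refine Set.Subset.antisymm hst fun x hx => ?_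
    obtain ⟨c, hc, hck⟩ := h (rk x) (rk_le_rk_top x)
    by_contra hxs
    have hne : c ≠ x := fun hcx => hxs (hcx ▸ hc)
    rcases ht (hst hc) hx hne with hle | hle
    · exact (rk_strictMono (lt_of_le_of_ne hle hne)).ne hck
    · exact (rk_strictMono (lt_of_le_of_ne hle hne.symm)).ne hck.symm⟩

/-- The maximal chain with prescribed elements of every rank. -/
def ofEl (f : ℕ → L) (hf : ∀ k ≤ rk (⊤ : L), rk (f k) = k)
    (hmono : ∀ k < rk (⊤ : L), f k ≤ f (k + 1)) : MaxChain L :=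
  ofRanks (f '' Set.Iic (rk (⊤ : L)))
    (by
      have hle : ∀ k ≤ rk (⊤ : L), ∀ j ≤ k, f j ≤ f k := by
        intro k
        induction k with
        | zero => intro _ j hj; rw [Nat.le_zero.1 hj]
        | succ k ih =>
          intro hk j hj
          rcases hj.eq_or_lt with rfl | hj
          · exact le_rfl
          · exact (ih (by omega) j (by omega)).trans (hmono k (by omega))
      rintro _ ⟨j, hj, rfl⟩ _ ⟨k, hk, rfl⟩ _
      rcases le_total j k with h | h
      · exact Or.inl (hle k hk j h)
      · exact Or.inr (hle j hj k h))
    (fun k hk => ⟨f k, ⟨k, hk, rfl⟩, hf k hk⟩)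

theorem el_ofEl {f : ℕ → L} {hf : ∀ k ≤ rk (⊤ : L), rk (f k) = k}
    {hmono : ∀ k < rk (⊤ : L), f k ≤ f (k + 1)} {k : ℕ} (hk : k ≤ rk (⊤ : L)) :
    (ofEl f hf hmono).el k = f k :=
  eq_of_rk_eq (el_mem _ _) (show f k ∈ f '' Set.Iic (rk (⊤ : L)) from ⟨k, hk, rfl⟩)
    (by rw [rk_el _ hk, hf k hk])

end MaxChain

instance : Finite (MaxChain L) := inferInstanceAs (Finite {C : Set L // IsMaxChain (· ≤ ·) C})

open Classical in
theorem chainExponent_apply (C : MaxChain L) (x : Interior L) :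
    chainExponent C x = if x.1 ∈ C.1 then 1 else 0 := by
  rfl

theorem chainExponent_injective : Function.Injective (chainExponent (L := L)) := by
  classical
  intro C D h
  refine MaxChain.ext_el fun k hk0 hk => ?_
  have hrk := C.rk_el hk.le
  let x : Interior L := ⟨C.el k, interior_iff.2 (by rw [hrk]; exact ⟨hk0, hk⟩)⟩
  have h1 : chainExponent C x = chainExponent D x := by rw [h]
  rw [chainExponent_apply, chainExponent_apply, if_pos (show x.1 ∈ C.1 from C.el_mem k)] at h1
  have h2 : C.el k ∈ D.1 := by
    by_contra h2
    change x.1 ∉ D.1 at h2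
    rw [if_neg h2] at h1
    exact one_ne_zero h1
  rw [MaxChain.mem_iff, hrk] at h2
  exact h2.symm

theorem degree_chainExponent (C : MaxChain L) : (chainExponent C).degree = rk (⊤ : L) - 1 := by
  classical
  have := Fintype.ofFinite (Interior L)
  rw [Finsupp.degree_eq_sum]
  simp_rw [chainExponent_apply]
  rw [Finset.sum_boole, Nat.cast_id]
  have hcard : (Finset.univ.filter fun x : Interior L => x.1 ∈ C.1).card
      = (Finset.Ioo 0 (rk (⊤ : L))).card := by
    refine Finset.card_bij (fun x _ => rk x.1) (fun x _ => ?_) (fun x hx y hy hxy => ?_)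
      (fun k hk => ?_)
    · exact Finset.mem_Ioo.2 (interior_iff.1 x.2)
    · exact Subtype.ext (MaxChain.eq_of_rk_eq (Finset.mem_filter.1 hx).2
        (Finset.mem_filter.1 hy).2 hxy)
    · rw [Finset.mem_Ioo] at hk
      exact ⟨⟨C.el k, interior_iff.2 (by rw [C.rk_el hk.2.le]; exact hk)⟩,
        Finset.mem_filter.2 ⟨Finset.mem_univ _, C.el_mem k⟩, C.rk_el hk.2.le⟩
  rw [hcard, Nat.card_Ioo, Nat.sub_zero]

end Rank

/-! ### Toric ideals with straightening relations of Hibi type -/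

section HibiToric

variable {K : Type*} [Field K] {M σ ι : Type*} [Lattice M]

/-- The rewriting rules `T_a T_b → T_{a ∧ b} T_{a ∨ b}` for incomparable elements `a`, `b` of a
lattice, with the variables indexed through an equivalence. -/
def hibiRules (c : ι ≃ M) : Set ((ι →₀ ℕ) × (ι →₀ ℕ)) :=
  {q | ∃ i j, ¬ c i ≤ c j ∧ ¬ c j ≤ c i ∧
    q = (Finsupp.single i 1 + Finsupp.single j 1,
      Finsupp.single (c.symm (c i ⊓ c j)) 1 + Finsupp.single (c.symm (c i ⊔ c j)) 1)}

theorem hibiRules_finite [Finite ι] (c : ι ≃ M) : (hibiRules c).Finite := by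
  refine (Set.finite_range (fun p : ι × ι => (Finsupp.single p.1 1 + Finsupp.single p.2 1,
    Finsupp.single (c.symm (c p.1 ⊓ c p.2)) 1 + Finsupp.single (c.symm (c p.1 ⊔ c p.2)) 1))).subset ?_
  rintro q ⟨i, j, -, -, rfl⟩
  exact ⟨(i, j), rfl⟩

theorem multidegree_eq_of_mem_hibiRules {u : M → (σ →₀ ℕ)} (c : ι ≃ M)
    (hu : ∀ a b, u a + u b = u (a ⊓ b) + u (a ⊔ b)) :
    ∀ q ∈ hibiRules c, multidegree (u ∘ c) q.1 = multidegree (u ∘ c) q.2 := by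
  rintro _ ⟨i, j, -, -, rfl⟩
  simp only [map_add, multidegree_single, Function.comp, Equiv.apply_symm_apply]
  exact hu _ _

/-- A monomial is reduced iff its support is a chain. -/
theorem isChain_of_isReducedMonomial {c : ι ≃ M} {e : ι →₀ ℕ}
    (he : IsReducedMonomial (hibiRules c) e) :
    IsChain (· ≤ ·) ((e.mapDomain c).support : Set M) := by
  classical
  intro a ha b hb hab
  by_contra hcon
  rw [not_or] at hcon
  have h1 : ∀ a, a ∈ ((e.mapDomain c).support : Set M) → 0 < e (c.symm a) := by
    intro a ha
    have := Finsupp.mem_support_iff.1 ha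
    rw [← c.apply_symm_apply a, Finsupp.mapDomain_apply c.injective] at this
    exact Nat.pos_of_ne_zero this
  refine he _ ⟨c.symm a, c.symm b, by simpa using hcon.1, by simpa using hcon.2, rfl⟩ ?_
  have ha' := h1 a ha
  have hb' := h1 b hb
  intro k
  simp only [Finsupp.add_apply, Finsupp.single_apply]
  split_ifs with h2 h3 h3
  · exact absurd (c.symm.injective (h2.trans h3.symm)) hab
  · subst h2; omega
  · subst h3; omega
  · omega

theorem hibiRules_decreasing {m : ℕ} (c : Fin m ≃ M) (hc : ∀ i j, c i ≤ c j → i ≤ j) :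
    ∀ q ∈ hibiRules c, (degRevLex m).toSyn q.2 < (degRevLex m).toSyn q.1 := by
  rintro _ ⟨i, j, hij, hji, rfl⟩
  refine DegRevLex.lt_iff.2 (Or.inr ⟨by simp, c.symm (c i ⊔ c j), fun k hk => ?_, ?_⟩)
  · have h1 : ∀ l, c l ≤ c i ⊔ c j → l ≠ k := by
      rintro l hl rfl
      exact hk.not_ge (hc _ _ (by simpa using hl))
    rw [Finsupp.add_apply, Finsupp.add_apply, Finsupp.single_eq_of_ne' (h1 _ ?_),
      Finsupp.single_eq_of_ne' (h1 _ ?_), Finsupp.single_eq_of_ne' (h1 i le_sup_left),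
      Finsupp.single_eq_of_ne' (h1 j le_sup_right)]
    · simp
    · simp
  · rw [Finsupp.add_apply, Finsupp.add_apply, Finsupp.single_eq_same, Finsupp.single_eq_of_ne',
      Finsupp.single_eq_of_ne']
    · omega
    · intro h
      rw [Equiv.eq_symm_apply] at h
      exact hij (h ▸ le_sup_left)
    · intro h
      rw [Equiv.eq_symm_apply] at h
      exact hji (h ▸ le_sup_right)

/-- Multichains are determined by their multidegree. -/
def HasUniqueMultichains (u : M → (σ →₀ ℕ)) : Prop :=
  ∀ e e' : M →₀ ℕ, IsChain (· ≤ ·) (e.support : Set M) → IsChain (· ≤ ·) (e'.support : Set M) →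
    multidegree u e = multidegree u e' → e = e'

theorem HasUniqueMultichains.eq_of_isReducedMonomial {u : M → (σ →₀ ℕ)}
    (h : HasUniqueMultichains u) (c : ι ≃ M) (e e' : ι →₀ ℕ)
    (he : IsReducedMonomial (hibiRules c) e) (he' : IsReducedMonomial (hibiRules c) e')
    (hee' : multidegree (u ∘ c) e = multidegree (u ∘ c) e') : e = e' := by
  apply Finsupp.mapDomain_injective c.injective
  refine h _ _ (isChain_of_isReducedMonomial he) (isChain_of_isReducedMonomial he') ?_
  rw [multidegree, Finsupp.linearCombination_mapDomain, Finsupp.linearCombination_mapDomain]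
  exact hee'

theorem isHomogeneous_of_mem_binomials_hibiRules (c : ι ≃ M) {g : MvPolynomial ι K}
    (hg : g ∈ binomials K (hibiRules c)) : g.IsHomogeneous 2 := by
  obtain ⟨_, ⟨i, j, -, -, rfl⟩, rfl⟩ := hg
  exact (MvPolynomial.isHomogeneous_monomial _ (by simp)).sub
    (MvPolynomial.isHomogeneous_monomial _ (by simp))

theorem hasQuadraticGroebnerBasis_of_hasUniqueMultichains {u : M → (σ →₀ ℕ)}
    (hu : ∀ a b, u a + u b = u (a ⊓ b) + u (a ⊔ b)) (h : HasUniqueMultichains u) {m : ℕ}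
    (c : Fin m ≃ M) (hc : ∀ i j, c i ≤ c j → i ≤ j) :
    HasQuadraticGroebnerBasis (degRevLex m) (toricIdeal K (u ∘ c)) :=
  ⟨binomials K (hibiRules c), fun _ => isHomogeneous_of_mem_binomials_hibiRules c,
    isGroebnerBasis_binomials _ (hibiRules_finite c) (multidegree_eq_of_mem_hibiRules c hu)
      (hibiRules_decreasing c hc) (h.eq_of_isReducedMonomial c)⟩

theorem exists_monotone_enumeration (M : Type*) [PartialOrder M] [Finite M] :
    ∃ (m : ℕ) (c : Fin m ≃ M), ∀ i j, c i ≤ c j → i ≤ j := by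
  have : Finite (LinearExtension M) := inferInstanceAs (Finite M)
  have := Fintype.ofFinite (LinearExtension M)
  let f := Fintype.orderIsoFinOfCardEq (LinearExtension M) rfl
  let c : Fin _ ≃ M := f.toEquiv
  refine ⟨_, c, fun i j hij => ?_⟩
  have h : toLinearExtension (c i) ≤ toLinearExtension (c j) := toLinearExtension.monotone hij
  exact f.le_iff_le.1 h

theorem span_binomials_hibiRules :
    Ideal.span (binomials K (hibiRules (Equiv.refl M))) = hibiIdeal K M := by
  apply le_antisymm
  · apply Ideal.span_mono
    rintro _ ⟨_, ⟨a, b, -, -, rfl⟩, rfl⟩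
    refine ⟨a, b, ?_⟩
    simp [MvPolynomial.X, MvPolynomial.monomial_mul]
  · rw [hibiIdeal, Ideal.span_le]
    rintro _ ⟨a, b, rfl⟩
    by_cases hab : a ≤ b
    · rw [inf_eq_left.2 hab, sup_eq_right.2 hab, sub_self]
      exact Ideal.zero_mem _
    by_cases hba : b ≤ a
    · rw [inf_eq_right.2 hba, sup_eq_left.2 hba, mul_comm, sub_self]
      exact Ideal.zero_mem _
    refine Ideal.subset_span ⟨_, ⟨a, b, hab, hba, rfl⟩, ?_⟩
    simp [MvPolynomial.X, MvPolynomial.monomial_mul]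

theorem toricIdeal_eq_hibiIdeal [Finite M] {u : M → (σ →₀ ℕ)}
    (hu : ∀ a b, u a + u b = u (a ⊓ b) + u (a ⊔ b)) (h : HasUniqueMultichains u) :
    toricIdeal K u = hibiIdeal K M := by
  obtain ⟨m, c, hc⟩ := exists_monotone_enumeration M
  rw [← span_binomials_hibiRules]
  have hQ : ∀ q ∈ hibiRules (Equiv.refl M), multidegree u q.1 = multidegree u q.2 :=
    multidegree_eq_of_mem_hibiRules (Equiv.refl M) hu
  have huniq := h.eq_of_isReducedMonomial (Equiv.refl M)
  refine toricIdeal_eq_span_binomials (W := (degRevLex m).syn)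
    (fun e => (degRevLex m).toSyn (e.mapDomain c.symm)) hQ ?_ huniq
  rintro _ ⟨a, b, hab, hba, rfl⟩ e
  have hlt := hibiRules_decreasing c hc _ ⟨c.symm a, c.symm b, by simpa using hab,
    by simpa using hba, rfl⟩
  simp only [Equiv.apply_symm_apply] at hlt
  simp only [Equiv.refl_apply, Equiv.refl_symm, Finsupp.mapDomain_add, Finsupp.mapDomain_single]
  rw [map_add, map_add (degRevLex m).toSyn (Finsupp.mapDomain _ e)]
  exact add_lt_add_right hlt _

theorem isQuadraticallyGenerated_hibiIdeal : IsQuadraticallyGenerated (hibiIdeal K M) :=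
  ⟨_, fun _ => isHomogeneous_of_mem_binomials_hibiRules (Equiv.refl M),
    span_binomials_hibiRules.symm⟩

end HibiToric

/-! ### The lattice of maximal chains of a planar lattice -/

section ChainCover

variable {L : Type*} [DistribLattice L] [BoundedOrder L] [Finite L] {A B : Set (JoinIrr L)}

omit [BoundedOrder L] in
theorem IsChainCover.rk_eq (h : IsChainCover A B) (x : L) : rk x = coord A x + coord B x := by
  rw [rk, coord, coord, ← Set.ncard_union_eq]
  · congr 1
    ext p
    have : p ∈ A ∪ B := h.2.2.2 ▸ Set.mem_univ p
    constructor
    · intro hp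
      exact this.imp (fun hA => ⟨hA, hp⟩) (fun hB => ⟨hB, hp⟩)
    · rintro (hp | hp)
      · exact hp.2
      · exact hp.2
  · exact Set.disjoint_left.2 fun p hp hp' => Set.disjoint_left.1 h.2.2.1 hp.1 hp'.1

omit [BoundedOrder L] in
/-- The elements of a chain below `x` form an initial segment of the chain, so their number
determines them. -/
theorem le_of_coord_le_coord (hA : IsChain (· ≤ ·) A) {x y : L} (h : coord A x ≤ coord A y)
    {p : JoinIrr L} (hp : p ∈ A) (hpx : p.1 ≤ x) : p.1 ≤ y := by
  by_contra hpy
  refine (h.trans_lt (Set.ncard_lt_ncard ⟨?_, ?_⟩)).false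
  · rintro q ⟨hq, hqy⟩
    refine ⟨hq, ?_⟩
    rcases hA.total hp hq with hle | hle
    · exact absurd ((show p.1 ≤ q.1 from hle).trans hqy) hpy
    · exact (show q.1 ≤ p.1 from hle).trans hpx
  · intro hsub
    exact hpy (hsub ⟨hp, hpx⟩).2

theorem IsChainCover.le_of_coord_le (h : IsChainCover A B) {x y : L}
    (hA : coord A x ≤ coord A y) (hB : coord B x ≤ coord B y) : x ≤ y := by
  rw [le_iff_forall_joinIrr]
  intro p hp
  have : p ∈ A ∪ B := h.2.2.2 ▸ Set.mem_univ p
  rcases this with hpA | hpB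
  · exact le_of_coord_le_coord h.1 hA hpA hp
  · exact le_of_coord_le_coord h.2.1 hB hpB hp

omit [BoundedOrder L] in
theorem coord_mono (A : Set (JoinIrr L)) {x y : L} (h : x ≤ y) : coord A x ≤ coord A y :=
  Set.ncard_le_ncard fun _ hp => ⟨hp.1, hp.2.trans h⟩

theorem IsChainCover.eq_of_coord_eq (h : IsChainCover A B) {x y : L} (hrk : rk x = rk y)
    (hA : coord A x = coord A y) : x = y := by
  rw [h.rk_eq, h.rk_eq] at hrk
  exact le_antisymm (h.le_of_coord_le (by omega) (by omega))
    (h.le_of_coord_le (by omega) (by omega))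

theorem IsChainCover.chainLE_iff (h : IsChainCover A B) {C D : MaxChain L} :
    ChainLE A B C D ↔ ∀ k ≤ rk (⊤ : L), coord A (C.el k) ≤ coord A (D.el k) := by
  constructor
  · intro hCD k hk
    refine hCD _ (C.el_mem k) _ (D.el_mem k) ?_
    rw [← h.rk_eq, ← h.rk_eq, C.rk_el hk, D.rk_el hk]
  · intro hCD c hc d hd hcd
    rw [← h.rk_eq, ← h.rk_eq] at hcd
    have := hCD (rk c) (rk_le_rk_top c)
    rwa [MaxChain.el_rk hc, hcd, MaxChain.el_rk hd] at this

/-- The infimum of two maximal chains: at each rank, the element with the smaller first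
coordinate. -/
noncomputable def IsChainCover.chainInf (h : IsChainCover A B) (C D : MaxChain L) : MaxChain L :=
  MaxChain.ofEl (fun k => if coord A (C.el k) ≤ coord A (D.el k) then C.el k else D.el k)
    (fun k hk => by split_ifs <;> simp [MaxChain.rk_el, hk])
    (fun k hk => by
      have h1 := coord_mono A (C.el_mono k.le_succ hk)
      have h2 := coord_mono A (D.el_mono k.le_succ hk)
      have h3 := coord_mono B (C.el_mono k.le_succ hk)
      have h4 := coord_mono B (D.el_mono k.le_succ hk)
      have h5 := h.rk_eq (C.el k)
      have h6 := h.rk_eq (D.el k)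
      have h7 := h.rk_eq (C.el (k + 1))
      have h8 := h.rk_eq (D.el (k + 1))
      rw [MaxChain.rk_el _ hk.le] at h5 h6
      rw [MaxChain.rk_el _ hk] at h7 h8
      simp only [Nat.succ_eq_add_one] at h1 h2 h3 h4
      split_ifs <;> refine h.le_of_coord_le ?_ ?_ <;> omega)

/-- The supremum of two maximal chains: at each rank, the element with the larger first
coordinate. -/
noncomputable def IsChainCover.chainSup (h : IsChainCover A B) (C D : MaxChain L) : MaxChain L :=
  MaxChain.ofEl (fun k => if coord A (C.el k) ≤ coord A (D.el k) then D.el k else C.el k)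
    (fun k hk => by split_ifs <;> simp [MaxChain.rk_el, hk])
    (fun k hk => by
      have h1 := coord_mono A (C.el_mono k.le_succ hk)
      have h2 := coord_mono A (D.el_mono k.le_succ hk)
      have h3 := coord_mono B (C.el_mono k.le_succ hk)
      have h4 := coord_mono B (D.el_mono k.le_succ hk)
      have h5 := h.rk_eq (C.el k)
      have h6 := h.rk_eq (D.el k)
      have h7 := h.rk_eq (C.el (k + 1))
      have h8 := h.rk_eq (D.el (k + 1))
      rw [MaxChain.rk_el _ hk.le] at h5 h6
      rw [MaxChain.rk_el _ hk] at h7 h8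
      simp only [Nat.succ_eq_add_one] at h1 h2 h3 h4
      split_ifs <;> refine h.le_of_coord_le ?_ ?_ <;> omega)

theorem IsChainCover.el_chainInf (h : IsChainCover A B) (C D : MaxChain L) {k : ℕ}
    (hk : k ≤ rk (⊤ : L)) : (h.chainInf C D).el k =
      if coord A (C.el k) ≤ coord A (D.el k) then C.el k else D.el k :=
  MaxChain.el_ofEl hk

theorem IsChainCover.el_chainSup (h : IsChainCover A B) (C D : MaxChain L) {k : ℕ}
    (hk : k ≤ rk (⊤ : L)) : (h.chainSup C D).el k =
      if coord A (C.el k) ≤ coord A (D.el k) then D.el k else C.el k :=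
  MaxChain.el_ofEl hk

/-- The distributive lattice of maximal chains, a sublattice of a power of `ℕ` through the first
coordinates of the elements of every rank. -/
noncomputable abbrev IsChainCover.chainLattice (h : IsChainCover A B) :
    DistribLattice (MaxChain L) :=
  letI : LE (MaxChain L) := ⟨ChainLE A B⟩
  letI : LT (MaxChain L) := ⟨fun C D => ChainLE A B C D ∧ ¬ ChainLE A B D C⟩
  letI : Min (MaxChain L) := ⟨h.chainInf⟩
  letI : Max (MaxChain L) := ⟨h.chainSup⟩
  have hle : ∀ C D : MaxChain L, ((fun k : Fin (rk (⊤ : L) + 1) => coord A (C.el k)) ≤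
      fun k : Fin (rk (⊤ : L) + 1) => coord A (D.el k)) ↔ ChainLE A B C D := fun C D => by
    rw [h.chainLE_iff]
    exact ⟨fun hCD k hk => hCD ⟨k, Nat.lt_succ_of_le hk⟩,
      fun hCD k => hCD k (Nat.le_of_lt_succ k.2)⟩
  Function.Injective.distribLattice
    (fun (C : MaxChain L) (k : Fin (rk (⊤ : L) + 1)) => coord A (C.el k))
    (fun C D hCD => MaxChain.ext_el fun k _ hk => h.eq_of_coord_eq
      (by rw [C.rk_el hk.le, D.rk_el hk.le]) (congrFun hCD ⟨k, by omega⟩))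
    (hle _ _)
    (by
      intro C D
      rw [lt_iff_le_not_ge, hle, hle]
      rfl)
    (fun C D => by
      funext k
      change coord A ((h.chainSup C D).el k) = max (coord A (C.el k)) (coord A (D.el k))
      rw [h.el_chainSup _ _ (Nat.le_of_lt_succ k.2)]
      split_ifs <;> omega)
    (fun C D => by
      funext k
      change coord A ((h.chainInf C D).el k) = min (coord A (C.el k)) (coord A (D.el k))
      rw [h.el_chainInf _ _ (Nat.le_of_lt_succ k.2)]
      split_ifs <;> omega)

theorem IsChainCover.chainExponent_add (h : IsChainCover A B) (C D : MaxChain L) :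
    chainExponent C + chainExponent D
      = chainExponent (h.chainInf C D) + chainExponent (h.chainSup C D) := by
  classical
  ext x
  have hx := rk_le_rk_top x.1
  simp only [Finsupp.add_apply, chainExponent_apply, MaxChain.mem_iff, h.el_chainInf _ _ hx,
    h.el_chainSup _ _ hx]
  by_cases hc : coord A (C.el (rk x.1)) ≤ coord A (D.el (rk x.1))
  · simp only [if_pos hc]
  · simp only [if_neg hc]
    exact add_comm _ _

theorem multidegree_chainExponent_pos {e : MaxChain L →₀ ℕ} {x : Interior L} :
    0 < multidegree chainExponent e x ↔ ∃ C ∈ e.support, x.1 ∈ C.1 := by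
  classical
  have := Fintype.ofFinite (MaxChain L)
  rw [multidegree_apply, Nat.pos_iff_ne_zero, Ne, Finset.sum_eq_zero_iff, not_forall]
  simp_rw [chainExponent_apply]
  refine exists_congr fun C => ?_
  simp [and_comm]

theorem chainExponent_ne_zero_of_support (hL : 2 ≤ rk (⊤ : L)) {e : MaxChain L →₀ ℕ}
    (he : e ≠ 0) : multidegree chainExponent e ≠ 0 := by
  obtain ⟨C, hC⟩ := Finsupp.support_nonempty_iff.2 he
  let x : Interior L := ⟨C.el 1, interior_iff.2 (by rw [C.rk_el (by omega)]; omega)⟩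
  have := multidegree_chainExponent_pos.2 ⟨C, hC, show x.1 ∈ C.1 from C.el_mem 1⟩
  intro h
  rw [h] at this
  exact this.false

/-- A multichain in the lattice of maximal chains is determined by the product of its monomials:
the product determines the smallest member, whose element of rank `k` has the smallest first
coordinate among the variables of rank `k` in the product. -/
theorem IsChainCover.hasUniqueMultichains (h : IsChainCover A B) (hL : 2 ≤ rk (⊤ : L)) :
    letI := h.chainLattice
    HasUniqueMultichains (chainExponent (L := L)) := by
  classical
  let := h.chainLattice
  have hmin : ∀ e : MaxChain L →₀ ℕ, IsChain (· ≤ ·) (e.support : Set (MaxChain L)) → e ≠ 0 →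
      ∃ C ∈ e.support, ∀ D ∈ e.support, C ≤ D := by
    intro e he he0
    obtain ⟨C, hC, hm⟩ := e.support.exists_minimal (Finsupp.support_nonempty_iff.2 he0)
    refine ⟨C, hC, fun D hD => ?_⟩
    rcases he.total hC hD with hle | hle
    · exact hle
    · exact hm hD hle
  have hcoord : ∀ (e e' : MaxChain L →₀ ℕ) (C C' : MaxChain L),
      multidegree chainExponent e = multidegree chainExponent e' →
      (∀ D ∈ e.support, C ≤ D) → C' ∈ e'.support → ∀ k, 0 < k → k < rk (⊤ : L) →
      coord A (C.el k) ≤ coord A (C'.el k) := by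
    intro e e' C C' hee' hC hC' k hk0 hk
    let x : Interior L := ⟨C'.el k, interior_iff.2 (by rw [C'.rk_el hk.le]; exact ⟨hk0, hk⟩)⟩
    have h1 := multidegree_chainExponent_pos.2 ⟨C', hC', show x.1 ∈ C'.1 from C'.el_mem k⟩
    rw [← hee', multidegree_chainExponent_pos] at h1
    obtain ⟨D, hD, hxD⟩ := h1
    have h2 : D.el k = C'.el k := by
      have := MaxChain.el_rk hxD
      rwa [show rk x.1 = k from C'.rk_el hk.le] at this
    rw [← h2]
    exact h.chainLE_iff.1 (hC D hD) k hk.le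
  intro e
  induction hn : e.degree generalizing e with
  | zero =>
    intro e' _ _ hee'
    rw [Finsupp.degree_eq_zero_iff] at hn
    subst hn
    by_contra hne
    exact chainExponent_ne_zero_of_support hL (Ne.symm hne) (by rw [← hee', map_zero])
  | succ n ih =>
    intro e' he he' hee'
    have he0 : e ≠ 0 := by rintro rfl; simp at hn
    have he0' : e' ≠ 0 := by
      rintro rfl
      exact chainExponent_ne_zero_of_support hL he0 (by rw [hee', map_zero])
    obtain ⟨C, hC, hCm⟩ := hmin e he he0
    obtain ⟨C', hC', hCm'⟩ := hmin e' he' he0'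
    have hCC' : C = C' := MaxChain.ext_el fun k hk0 hk => h.eq_of_coord_eq
      (by rw [C.rk_el hk.le, C'.rk_el hk.le])
      (le_antisymm (hcoord e e' C C' hee' hCm hC' k hk0 hk)
        (hcoord e' e C' C hee'.symm hCm' hC k hk0 hk))
    subst hCC'
    have hle : ∀ f : MaxChain L →₀ ℕ, C ∈ f.support → Finsupp.single C 1 ≤ f := fun f hf =>
      Finsupp.single_le_iff.2 (Nat.one_le_iff_ne_zero.2 (Finsupp.mem_support_iff.1 hf))
    obtain ⟨f, rfl⟩ := exists_add_of_le (hle e hC)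
    obtain ⟨f', rfl⟩ := exists_add_of_le (hle e' hC')
    have hsub : ∀ f : MaxChain L →₀ ℕ,
        (f.support : Set (MaxChain L)) ⊆ (Finsupp.single C 1 + f).support := by
      intro f D hD
      have := Finsupp.mem_support_iff.1 hD
      exact Finsupp.mem_support_iff.2 (by rw [Finsupp.add_apply]; omega)
    rw [map_add, map_add, add_right_inj] at hee'
    rw [map_add, Finsupp.degree_single] at hn
    rw [ih f (by omega) f' (he.mono (hsub f)) (he'.mono (hsub f')) hee']

end ChainCover

/-! ### The chain algebra as a Hibi ring -/

section ChainAlgebra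

variable {K : Type*} [Field K] {L : Type*} [DistribLattice L] [BoundedOrder L] [Finite L]

/-- The chain algebra is the quotient of the polynomial ring by the defining ideal. -/
theorem exists_quotient_chainIdeal_algEquiv :
    ∃ e : (MvPolynomial (MaxChain L) K ⧸ chainIdeal K L) ≃ₐ[K] chainAlgebra K L,
      ∀ C, (e (Ideal.Quotient.mk _ (MvPolynomial.X C)) : MvPolynomial (Interior L) K)
        = chainMonomial K C := by
  let f : MvPolynomial (MaxChain L) K →ₐ[K] MvPolynomial (Interior L) K :=
    MvPolynomial.aeval (chainMonomial K)
  have hr : f.range = chainAlgebra K L := by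
    rw [chainAlgebra, Algebra.adjoin_range_eq_range_aeval]
  have hker : chainIdeal K L = RingHom.ker f.rangeRestrict := by
    rw [AlgHom.ker_rangeRestrict]
    rfl
  refine ⟨(Ideal.quotientEquivAlgOfEq K hker).trans
    ((Ideal.quotientKerAlgEquivOfSurjective f.rangeRestrict_surjective).trans
      (Subalgebra.equivOfEq _ _ hr)), fun C => ?_⟩
  change f (MvPolynomial.X C) = _
  exact MvPolynomial.aeval_X _ _

theorem IsChainCover.chainIdeal_eq_hibiIdeal {A B : Set (JoinIrr L)} (h : IsChainCover A B)
    (hL : 2 ≤ rk (⊤ : L)) :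
    letI := h.chainLattice
    chainIdeal K L = hibiIdeal K (MaxChain L) :=
  let := h.chainLattice
  toricIdeal_eq_hibiIdeal h.chainExponent_add (h.hasUniqueMultichains hL)

theorem IsChainCover.exists_hibiRing_algEquiv {A B : Set (JoinIrr L)} (h : IsChainCover A B)
    (hL : 2 ≤ rk (⊤ : L)) :
    letI := h.chainLattice
    ∃ e : HibiRing K (MaxChain L) ≃ₐ[K] chainAlgebra K L, ∀ C : MaxChain L,
      (e (Ideal.Quotient.mk (hibiIdeal K (MaxChain L)) (MvPolynomial.X C)) :
        MvPolynomial (Interior L) K) = chainMonomial K C := by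
  let := h.chainLattice
  obtain ⟨e, he⟩ := exists_quotient_chainIdeal_algEquiv (K := K) (L := L)
  exact ⟨(Ideal.quotientEquivAlgOfEq K (h.chainIdeal_eq_hibiIdeal hL).symm).trans e, he⟩

theorem IsChainCover.hasQuadraticGroebnerBasis {A B : Set (JoinIrr L)} (h : IsChainCover A B)
    (hL : 2 ≤ rk (⊤ : L)) {m : ℕ} (C : Fin m ≃ MaxChain L)
    (hC : ∀ i j, ChainLE A B (C i) (C j) → i ≤ j) :
    HasQuadraticGroebnerBasis (degRevLex m) (chainIdealEnum K C) :=
  let := h.chainLattice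
  hasQuadraticGroebnerBasis_of_hasUniqueMultichains h.chainExponent_add
    (h.hasUniqueMultichains hL) C hC

/-- The Hibi ring only depends on the lattice up to isomorphism; in particular the lattice can be
taken in the lowest universe. -/
theorem isHibiRing_of_algEquiv {M : Type*} [DistribLattice M] [Finite M] [Nonempty M]
    {R : Type*} [CommRing R] [Algebra K R] (e : HibiRing K M ≃ₐ[K] R) : IsHibiRing K R := by
  let c : Fin (Nat.card M) ≃ M := (Finite.equivFin M).symm
  let iLE : LE (Fin (Nat.card M)) := ⟨fun i j => c i ≤ c j⟩
  let iLT : LT (Fin (Nat.card M)) := ⟨fun i j => c i < c j⟩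
  let iMin : Min (Fin (Nat.card M)) := ⟨fun i j => c.symm (c i ⊓ c j)⟩
  let iMax : Max (Fin (Nat.card M)) := ⟨fun i j => c.symm (c i ⊔ c j)⟩
  let inst : DistribLattice (Fin (Nat.card M)) := @Function.Injective.distribLattice _ _ iMax iMin
    iLE iLT _ c c.injective Iff.rfl Iff.rfl (fun i j => c.apply_symm_apply _)
    (fun i j => c.apply_symm_apply _)
  have hinf : ∀ i j, c (inst.inf i j) = c i ⊓ c j := fun i j => c.apply_symm_apply _
  have hsup : ∀ i j, c (inst.sup i j) = c i ⊔ c j := fun i j => c.apply_symm_apply _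
  let r := MvPolynomial.renameEquiv K c
  have hI : hibiIdeal K M = (@hibiIdeal K _ (Fin (Nat.card M)) inst.toLattice).map
      (r : MvPolynomial (Fin (Nat.card M)) K →+* MvPolynomial M K) := by
    rw [hibiIdeal, hibiIdeal, Ideal.map_span]
    congr 1
    ext f
    constructor
    · rintro ⟨a, b, rfl⟩
      refine ⟨_, ⟨c.symm a, c.symm b, rfl⟩, ?_⟩
      change r _ = _
      simp only [map_sub, map_mul, r, MvPolynomial.renameEquiv_apply, MvPolynomial.rename_X]
      erw [hinf, hsup]
      simp
    · rintro ⟨_, ⟨i, j, rfl⟩, rfl⟩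
      refine ⟨c i, c j, ?_⟩
      change r _ = _
      simp only [map_sub, map_mul, r, MvPolynomial.renameEquiv_apply, MvPolynomial.rename_X]
      erw [hinf, hsup]
  exact ⟨Fin (Nat.card M), inst, inferInstance, ⟨c.symm (Classical.arbitrary M)⟩,
    ⟨e.symm.trans (Ideal.quotientEquivAlg _ _ r hI).symm⟩⟩

theorem IsChainCover.isHibiRing {A B : Set (JoinIrr L)} (h : IsChainCover A B)
    (hL : 2 ≤ rk (⊤ : L)) : IsHibiRing K (chainAlgebra K L) := by
  let := h.chainLattice
  obtain ⟨e, -⟩ := h.exists_hibiRing_algEquiv (K := K) hL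
  have : Nonempty (MaxChain L) := by
    obtain ⟨s, hs, -⟩ := (IsChain.empty (r := ((· ≤ ·) : L → L → Prop))).exists_maxChain
    exact ⟨⟨s, hs⟩⟩
  exact isHibiRing_of_algEquiv e

theorem IsChainCover.exists_hasQuadraticGroebnerBasis {A B : Set (JoinIrr L)}
    (h : IsChainCover A B) (hL : 2 ≤ rk (⊤ : L)) : ∃ (m : ℕ) (C : Fin m ≃ MaxChain L),
      HasQuadraticGroebnerBasis (degRevLex m) (chainIdealEnum K C) := by
  let := h.chainLattice
  obtain ⟨m, c, hc⟩ := exists_monotone_enumeration (MaxChain L)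
  exact ⟨m, c, h.hasQuadraticGroebnerBasis hL c hc⟩

end ChainAlgebra

/-! ### The cubic relation of a lattice that is not planar -/

section Hexagon

variable {L : Type*} [DistribLattice L] [BoundedOrder L] [Finite L]

omit [BoundedOrder L] in
theorem rk_sup_joinIrr {x : L} {p : JoinIrr L} (hp : ¬ p.1 ≤ x) (hlt : ∀ q < p, q.1 ≤ x) :
    rk (x ⊔ p.1) = rk x + 1 := by
  have hset : {q : JoinIrr L | q.1 ≤ x ⊔ p.1} = insert p {q : JoinIrr L | q.1 ≤ x} := by
    ext q
    change q.1 ≤ x ⊔ p.1 ↔ q = p ∨ q.1 ≤ x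
    rw [joinIrr_le_sup]
    constructor
    · rintro (h | h)
      · exact Or.inr h
      · exact (eq_or_lt_of_le (show q ≤ p from h)).imp id (hlt q)
    · rintro (rfl | h)
      · exact Or.inr le_rfl
      · exact Or.inl h
  have hp' : p ∉ {q : JoinIrr L | q.1 ≤ x} := hp
  rw [rk, hset, Set.ncard_insert_of_notMem hp', rk]

variable (L) in
/-- The proper part of an interval of a lattice that is a Boolean algebra of rank three: its atoms
`v i` and coatoms `w j`, where `v i ≤ w j` iff `i ≠ j`. The comparability graph of these elements
is a hexagon. The bottom and the top of the interval are the elements of rank `r` and `r + 3` of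
the maximal chain `base`. -/
structure Hexagon where
  /-- A maximal chain through the bottom and the top of the interval. -/
  base : MaxChain L
  /-- The rank of the bottom of the interval. -/
  r : ℕ
  /-- The atoms of the interval. -/
  v : Fin 3 → L
  /-- The coatoms of the interval. -/
  w : Fin 3 → L
  rk_v : ∀ i, rk (v i) = r + 1
  rk_w : ∀ i, rk (w i) = r + 2
  v_le_w : ∀ i j, v i ≤ w j ↔ i ≠ j
  r_le : r + 3 ≤ rk (⊤ : L)
  base_le_v : ∀ i, base.el r ≤ v i
  w_le_base : ∀ i, w i ≤ base.el (r + 3)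

/-- Three pairwise incomparable join-irreducible elements give a Boolean interval of rank three,
starting at the join of all join-irreducible elements strictly below one of them. -/
theorem nonempty_hexagon {p : Fin 3 → JoinIrr L} (hp : ∀ i j, i ≠ j → ¬ p i ≤ p j) :
    Nonempty (Hexagon L) := by
  classical
  have := Fintype.ofFinite (JoinIrr L)
  set z : L := (Finset.univ.filter fun q : JoinIrr L => ∃ i, q < p i).sup Subtype.val with hz
  have hpz : ∀ i, ¬ (p i).1 ≤ z := by
    intro i hi
    obtain ⟨q, hq, hle⟩ := ((p i).2.supPrime.le_finset_sup).1 hi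
    obtain ⟨j, hj⟩ := (Finset.mem_filter.1 hq).2
    have hlt : p i < p j := lt_of_le_of_lt hle hj
    rcases eq_or_ne i j with rfl | hij
    · exact hlt.false
    · exact hp i j hij hlt.le
  have hqz : ∀ i, ∀ q < p i, q.1 ≤ z := fun i q hq =>
    Finset.le_sup (f := Subtype.val) (Finset.mem_filter.2 ⟨Finset.mem_univ q, i, hq⟩)
  have hpp : ∀ i j, (p i).1 ≤ (p j).1 ↔ i = j := fun i j =>
    ⟨fun h => by_contra fun hij => hp i j hij h, fun h => h ▸ le_rfl⟩
  have h3 : ∀ i j : Fin 3, i = j + 1 ∨ i = j + 2 ↔ i ≠ j := by decide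
  let v : Fin 3 → L := fun i => z ⊔ (p i).1
  let w : Fin 3 → L := fun j => v (j + 1) ⊔ (p (j + 2)).1
  let y : L := w 0 ⊔ (p 0).1
  have hzv : ∀ i, z ≤ v i := fun i => le_sup_left
  have hzw : ∀ i, z ≤ w i := fun i => (hzv _).trans le_sup_left
  have hpv : ∀ i j, (p i).1 ≤ v j ↔ i = j := fun i j => by
    rw [joinIrr_le_sup, hpp, or_iff_right (hpz i)]
  have hpw : ∀ i j, (p i).1 ≤ w j ↔ i ≠ j := fun i j => by
    rw [joinIrr_le_sup, hpp, hpv, h3]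
  have hpy : ∀ i, (p i).1 ≤ y := fun i => by
    rw [joinIrr_le_sup, hpw, hpp]
    exact (em (i = 0)).symm
  have hzy : z ≤ y := (hzw 0).trans le_sup_left
  have hvy : ∀ i, v i ≤ y := fun i => sup_le hzy (hpy i)
  have hwy : ∀ i, w i ≤ y := fun i => sup_le (hvy _) (hpy _)
  have hrv : ∀ i, rk (v i) = rk z + 1 := fun i => rk_sup_joinIrr (hpz i) (hqz i)
  have hrw : ∀ i, rk (w i) = rk z + 2 := fun i => by
    have h := rk_sup_joinIrr (x := v (i + 1)) (p := p (i + 2))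
      (by rw [hpv]; revert i; decide) (fun q hq => (hqz _ q hq).trans (hzv _))
    rw [hrv] at h
    exact h
  have hry : rk y = rk z + 3 := by
    have h := rk_sup_joinIrr (x := w 0) (p := p 0)
      (by rw [hpw]; exact fun h => h rfl) (fun q hq => (hqz _ q hq).trans (hzw _))
    rw [hrw] at h
    exact h
  obtain ⟨s, hs, hsub⟩ := (IsChain.pair (r := ((· ≤ ·) : L → L → Prop)) hzy).exists_maxChain
  have hel : ∀ x ∈ s, MaxChain.el ⟨s, hs⟩ (rk x) = x :=
    fun x hx => MaxChain.el_rk (C := ⟨s, hs⟩) hx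
  have hez := hel z (hsub (by simp))
  have hey := hel y (hsub (by simp))
  rw [hry] at hey
  exact ⟨⟨⟨s, hs⟩, rk z, v, w, hrv, hrw,
    fun i j => ⟨fun h => (hpw i j).1 (le_sup_right.trans h),
      fun h => sup_le (hzw j) ((hpw i j).2 h)⟩,
    hry ▸ rk_le_rk_top y, fun i => by rw [hez]; exact hzv i, fun i => by rw [hey]; exact hwy i⟩⟩

namespace Hexagon

variable (H : Hexagon L)

theorem v_injective : Function.Injective H.v := by
  intro i j h
  by_contra hij
  exact (H.v_le_w j j).1 (h ▸ (H.v_le_w i j).2 hij) rfl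

theorem w_injective : Function.Injective H.w := by
  intro i j h
  by_contra hij
  exact (H.v_le_w i i).1 (h ▸ (H.v_le_w i j).2 hij) rfl

/-- The maximal chain that passes through the edge `v i < w j` of the hexagon and agrees with the
base chain outside of the interval. -/
noncomputable def chain (i j : Fin 3) (hij : i ≠ j) : MaxChain L :=
  MaxChain.ofEl
    (fun k => if k = H.r + 1 then H.v i else if k = H.r + 2 then H.w j else H.base.el k)
    (fun k hk => by
      split_ifs with h1 h2
      · rw [H.rk_v, h1]
      · rw [H.rk_w, h2]
      · exact H.base.rk_el hk)
    (fun k hk => by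
      split_ifs with h1 h2 h3 h4 h5 h6 h7 h8
      any_goals omega
      · exact (H.v_le_w i j).2 hij
      · rw [show k + 1 = H.r + 3 by omega]
        exact H.w_le_base j
      · rw [show k = H.r by omega]
        exact H.base_le_v i
      · exact H.base.el_mono k.le_succ hk)

theorem el_chain {i j : Fin 3} (hij : i ≠ j) {k : ℕ} (hk : k ≤ rk (⊤ : L)) :
    (H.chain i j hij).el k =
      if k = H.r + 1 then H.v i else if k = H.r + 2 then H.w j else H.base.el k :=
  MaxChain.el_ofEl hk

/-- The six maximal chains through an edge of the hexagon; the second index separates the two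
perfect matchings of the hexagon. -/
noncomputable def edge (q : Fin 3 × Bool) : MaxChain L :=
  H.chain q.1 (if q.2 then q.1 + 1 else q.1 + 2) (by
    revert q
    decide)

theorem el_edge_v (q : Fin 3 × Bool) : (H.edge q).el (H.r + 1) = H.v q.1 := by
  have := H.r_le
  rw [edge, H.el_chain _ (by omega), if_pos rfl]

theorem el_edge_w (q : Fin 3 × Bool) :
    (H.edge q).el (H.r + 2) = H.w (if q.2 then q.1 + 1 else q.1 + 2) := by
  have := H.r_le
  rw [edge, H.el_chain _ (by omega), if_neg (by omega), if_pos rfl]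

theorem el_edge_of_ne (q : Fin 3 × Bool) {k : ℕ} (hk : k ≤ rk (⊤ : L)) (h1 : k ≠ H.r + 1)
    (h2 : k ≠ H.r + 2) : (H.edge q).el k = H.base.el k := by
  rw [edge, H.el_chain _ hk, if_neg h1, if_neg h2]

theorem edge_injective : Function.Injective H.edge := by
  intro q q' h
  have h1 := H.el_edge_v q
  have h2 := H.el_edge_w q
  rw [h, H.el_edge_v] at h1
  rw [h, H.el_edge_w] at h2
  have key : ∀ q q' : Fin 3 × Bool, q'.1 = q.1 →
      (if q'.2 then q'.1 + 1 else q'.1 + 2) = (if q.2 then q.1 + 1 else q.1 + 2) → q = q' := by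
    decide
  exact key q q' (H.v_injective h1) (H.w_injective h2)

theorem v_mem_edge {i : Fin 3} {q : Fin 3 × Bool} : H.v i ∈ (H.edge q).1 ↔ q.1 = i := by
  rw [MaxChain.mem_iff, H.rk_v, el_edge_v, H.v_injective.eq_iff]

theorem w_mem_edge {i : Fin 3} {q : Fin 3 × Bool} :
    H.w i ∈ (H.edge q).1 ↔ (if q.2 then q.1 + 1 else q.1 + 2) = i := by
  rw [MaxChain.mem_iff, H.rk_w, el_edge_w, H.w_injective.eq_iff]

/-- One of the two perfect matchings of the hexagon, as a multiset of maximal chains. -/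
noncomputable def matching (b : Bool) : MaxChain L →₀ ℕ := ∑ i, Finsupp.single (H.edge (i, b)) 1

theorem matching_eq_mapDomain (b : Bool) :
    H.matching b = Finsupp.mapDomain H.edge (∑ i, Finsupp.single (i, b) 1) := by
  rw [matching, Finsupp.mapDomain_finsetSum]
  simp [Finsupp.mapDomain_single]

theorem mem_support_matching {b : Bool} {C : MaxChain L} :
    C ∈ (H.matching b).support ↔ ∃ i, C = H.edge (i, b) := by
  classical
  rw [Finsupp.mem_support_iff, matching, Finsupp.finsetSum_apply, Ne, Finset.sum_eq_zero_iff,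
    not_forall]
  simp [Finsupp.single_apply, eq_comm]

theorem multidegree_matching : multidegree chainExponent (H.matching false)
    = multidegree chainExponent (H.matching true) := by
  classical
  ext x
  have hx := rk_le_rk_top x.1
  simp only [matching, Fin.sum_univ_three, map_add, multidegree_single, Finsupp.add_apply,
    chainExponent_apply]
  by_cases h1 : rk x.1 = H.r + 1
  · simp only [MaxChain.mem_iff, h1, el_edge_v]
  by_cases h2 : rk x.1 = H.r + 2
  · simp only [MaxChain.mem_iff, h2, el_edge_w]
    simp only [Bool.false_eq_true, if_false, if_true, zero_add, show (1 + 2 : Fin 3) = 0 from rfl,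
      show (2 + 2 : Fin 3) = 1 from rfl, show (1 + 1 : Fin 3) = 2 from rfl,
      show (2 + 1 : Fin 3) = 0 from rfl]
    omega
  · simp only [MaxChain.mem_iff, H.el_edge_of_ne _ hx h1 h2]

/-- A maximal chain all of whose elements occur in the product of a perfect matching passes through
an edge of the hexagon. -/
theorem exists_eq_edge {e : MaxChain L →₀ ℕ}
    (he : multidegree chainExponent e = multidegree chainExponent (H.matching false))
    {D : MaxChain L} (hD : D ∈ e.support) : ∃ q, H.edge q = D := by
  have hr := H.r_le
  have key : ∀ k, 0 < k → k < rk (⊤ : L) → ∃ q, D.el k = (H.edge q).el k := by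
    intro k hk0 hk
    let x : Interior L := ⟨D.el k, interior_iff.2 (by rw [D.rk_el hk.le]; exact ⟨hk0, hk⟩)⟩
    have h1 := multidegree_chainExponent_pos.2 ⟨D, hD, show x.1 ∈ D.1 from D.el_mem k⟩
    rw [he, multidegree_chainExponent_pos] at h1
    obtain ⟨C, hC, hxC⟩ := h1
    obtain ⟨i, rfl⟩ := H.mem_support_matching.1 hC
    have := MaxChain.el_rk hxC
    rw [show rk x.1 = k from D.rk_el hk.le] at this
    exact ⟨_, this.symm⟩
  obtain ⟨q, hq⟩ := key (H.r + 1) (by omega) (by omega)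
  obtain ⟨q', hq'⟩ := key (H.r + 2) (by omega) (by omega)
  rw [el_edge_v] at hq
  rw [el_edge_w] at hq'
  have hle : D.el (H.r + 1) ≤ D.el (H.r + 2) := D.el_mono (by omega) (by omega)
  rw [hq, hq', H.v_le_w] at hle
  have h3 : ∀ (i j : Fin 3), i ≠ j → ∃ b : Bool, (if b then i + 1 else i + 2) = j := by decide
  obtain ⟨b, hb⟩ := h3 _ _ hle
  refine ⟨(q.1, b), MaxChain.ext_el fun k hk0 hk => ?_⟩
  by_cases h1 : k = H.r + 1
  · rw [h1, el_edge_v, hq]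
  by_cases h2 : k = H.r + 2
  · rw [h2, el_edge_w, hq', ← hb]
  · obtain ⟨q'', h⟩ := key k hk0 hk
    rw [h, H.el_edge_of_ne _ hk.le h1 h2, H.el_edge_of_ne _ hk.le h1 h2]

theorem v_interior (i : Fin 3) : H.v i ≠ ⊥ ∧ H.v i ≠ ⊤ := by
  have := H.r_le
  rw [interior_iff, H.rk_v]
  omega

theorem w_interior (i : Fin 3) : H.w i ≠ ⊥ ∧ H.w i ≠ ⊤ := by
  have := H.r_le
  rw [interior_iff, H.rk_w]
  omega

/-- The hexagon has exactly two perfect matchings, so they form a whole fibre of degree three. -/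
theorem isCubicFibre :
    IsCubicFibre (chainExponent (L := L)) (H.matching false) (H.matching true) where
  degree_left := by simp [matching]
  degree_right := by simp [matching]
  disjoint C := by
    by_contra! h
    obtain ⟨i, rfl⟩ := H.mem_support_matching.1 (Finsupp.mem_support_iff.2 h.1)
    obtain ⟨j, hj⟩ := H.mem_support_matching.1 (Finsupp.mem_support_iff.2 h.2)
    have := congrArg Prod.snd (H.edge_injective hj)
    simp at this
  multidegree_eq := H.multidegree_matching
  eq_or_eq e he := by
    classical
    have hrange : (e.support : Set (MaxChain L)) ⊆ Set.range H.edge :=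
      fun D hD => H.exists_eq_edge he hD
    obtain ⟨f, rfl⟩ : ∃ f, e = Finsupp.mapDomain H.edge f :=
      ⟨_, (Finsupp.mapDomain_comapDomain _ H.edge_injective e hrange).symm⟩
    have hm : ∀ f, multidegree chainExponent (Finsupp.mapDomain H.edge f)
        = multidegree (chainExponent ∘ H.edge) f := fun f =>
      Finsupp.linearCombination_mapDomain _ _ _
    rw [matching_eq_mapDomain, hm, hm] at he
    have hv : ∀ i, f (i, false) + f (i, true) = 1 := by
      intro i
      let x : Interior L := ⟨H.v i, H.v_interior i⟩
      have hx : x.1 = H.v i := rfl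
      have h1 : multidegree (chainExponent ∘ H.edge) f x = _ := DFunLike.congr_fun he x
      simp only [multidegree_apply, Function.comp, chainExponent_apply, hx, H.v_mem_edge,
        Fintype.sum_prod_type, Fintype.sum_bool, Fin.sum_univ_three, Finsupp.add_apply,
        Finsupp.single_apply, Prod.mk.injEq] at h1
      fin_cases i <;> simp at h1 ⊢ <;> omega
    have hw : ∀ i, f (i + 1, false) + f (i + 2, true) = 1 := by
      intro i
      let x : Interior L := ⟨H.w i, H.w_interior i⟩
      have hx : x.1 = H.w i := rfl
      have h1 : multidegree (chainExponent ∘ H.edge) f x = _ := DFunLike.congr_fun he x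
      simp only [multidegree_apply, Function.comp, chainExponent_apply, hx, H.w_mem_edge,
        Fintype.sum_prod_type, Fintype.sum_bool, Fin.sum_univ_three, Finsupp.add_apply,
        Finsupp.single_apply, Prod.mk.injEq] at h1
      fin_cases i <;> simp at h1 ⊢ <;> omega
    have hv0 := hv 0
    have hv1 := hv 1
    have hv2 := hv 2
    have hw0 := hw 0
    have hw1 := hw 1
    have hw2 := hw 2
    simp only [zero_add, show (1 + 2 : Fin 3) = 0 from rfl,
      show (2 + 2 : Fin 3) = 1 from rfl, show (1 + 1 : Fin 3) = 2 from rfl,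
      show (2 + 1 : Fin 3) = 0 from rfl] at hw0 hw1 hw2
    rw [matching_eq_mapDomain, matching_eq_mapDomain]
    rcases Nat.eq_zero_or_pos (f (0, true)) with h0 | h0
    · left
      congr 1
      ext ⟨i, b⟩
      simp only [Fin.sum_univ_three, Finsupp.add_apply, Finsupp.single_apply, Prod.mk.injEq]
      fin_cases i <;> cases b <;> simp <;> omega
    · right
      congr 1
      ext ⟨i, b⟩
      simp only [Fin.sum_univ_three, Finsupp.add_apply, Finsupp.single_apply, Prod.mk.injEq]
      fin_cases i <;> cases b <;> simp <;> omega

end Hexagon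

theorem nonempty_hexagon_of_not_isPlanarLattice (h : ¬ IsPlanarLattice L) :
    Nonempty (Hexagon L) := by
  obtain ⟨p, hp⟩ := exists_antichain_of_not_posetWidth_le_two h
  exact nonempty_hexagon hp

theorem isPlanarLattice_of_isQuadraticallyGenerated {K : Type*} [Field K]
    (h : IsQuadraticallyGenerated (chainIdeal K L)) : IsPlanarLattice L := by
  by_contra hL
  obtain ⟨H⟩ := nonempty_hexagon_of_not_isPlanarLattice hL
  exact H.isCubicFibre.not_isQuadraticallyGenerated h

/-- Cubic fibres are preserved when the variables are enumerated. -/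
theorem IsCubicFibre.comp_equiv {ι κ σ : Type*} {u : ι → (σ →₀ ℕ)} {e o : ι →₀ ℕ}
    (h : IsCubicFibre u e o) (c : κ ≃ ι) :
    IsCubicFibre (u ∘ c) (e.mapDomain c.symm) (o.mapDomain c.symm) := by
  have hm : ∀ f : κ →₀ ℕ, multidegree (u ∘ c) f = multidegree u (f.mapDomain c) := fun f =>
    (Finsupp.linearCombination_mapDomain _ _ _).symm
  have hc : ∀ f : ι →₀ ℕ, (f.mapDomain c.symm).mapDomain c = f := fun f => by
    rw [← Finsupp.mapDomain_comp]
    simp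
  have hd : ∀ f : ι →₀ ℕ, (f.mapDomain c.symm).degree = f.degree := fun f => by
    simp
  refine ⟨(hd e).trans h.degree_left, (hd o).trans h.degree_right, fun i => ?_, ?_, fun e' he' => ?_⟩
  · have := h.disjoint (c i)
    rwa [← c.symm_apply_apply i, Finsupp.mapDomain_apply c.symm.injective,
      Finsupp.mapDomain_apply c.symm.injective]
  · rw [hm, hm, hc, hc]
    exact h.multidegree_eq
  · rw [hm, hm, hc] at he'
    refine (h.eq_or_eq _ he').imp (fun h' => ?_) (fun h' => ?_) <;>
    · apply Finsupp.mapDomain_injective c.injective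
      rw [h', hc]

theorem isPlanarLattice_of_hasQuadraticGroebnerBasis {K : Type*} [Field K] {m : ℕ}
    (C : Fin m ≃ MaxChain L)
    (h : HasQuadraticGroebnerBasis (degRevLex m) (chainIdealEnum K C)) : IsPlanarLattice L := by
  by_contra hL
  obtain ⟨H⟩ := nonempty_hexagon_of_not_isPlanarLattice hL
  exact (H.isCubicFibre.comp_equiv C).not_hasQuadraticGroebnerBasis _ h

end Hexagon

/-! ### Sorting -/

section Sorting

variable {s : ℕ}

/-- The number of variables of index less than `k` in a monomial, counted with multiplicity. These
counts determine the monomial, and sorting a pair of monomials balances them. -/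
noncomputable def initialCount (k : ℕ) : (Fin s →₀ ℕ) →+ ℕ :=
  (Multiset.countPAddMonoidHom (fun i : Fin s => i.val < k)).comp
    Finsupp.toMultiset

theorem initialCount_apply (k : ℕ) (u : Fin s →₀ ℕ) :
    initialCount k u = (Finsupp.toMultiset u).countP (fun i => i.val < k) := rfl

theorem initialCount_single (k : ℕ) (i : Fin s) :
    initialCount k (Finsupp.single i 1) = if i.val < k then 1 else 0 := by
  rw [initialCount_apply, Finsupp.toMultiset_single, one_nsmul, ← Multiset.cons_zero,
    Multiset.countP_cons, Multiset.countP_zero, zero_add]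

theorem eq_of_initialCount_eq {u v : Fin s →₀ ℕ} (h : ∀ k, initialCount k u = initialCount k v) :
    u = v := by
  have key : ∀ (w : Fin s →₀ ℕ) (i : Fin s),
      initialCount (i.val + 1) w = initialCount i.val w + w i := by
    intro w i
    induction w using Finsupp.induction_linear with
    | zero => simp
    | add f g hf hg =>
      rw [map_add, map_add, hf, hg, Finsupp.add_apply]
      omega
    | single j n =>
      rw [← mul_one n, ← smul_eq_mul, ← Finsupp.smul_single, map_nsmul, map_nsmul,
        initialCount_single, initialCount_single, Finsupp.smul_apply, ← smul_add]
      congr 1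
      rw [Finsupp.single_apply]
      have : j = i ↔ j.val = i.val := Fin.ext_iff
      simp only [this]
      split_ifs <;> omega
  ext i
  have h1 := key u i
  have h2 := key v i
  rw [h, h] at h1
  omega

/-- In a sorted list, the entries less than `k` form an initial segment, which is distributed evenly
on the entries in odd and in even positions. -/
theorem countP_alternate (k : ℕ) (l : List (Fin s)) (hl : l.Pairwise (· ≤ ·)) :
    (alternate l).1.countP (fun i => i.val < k) = (l.countP (fun i => i.val < k) + 1) / 2 ∧
    (alternate l).2.countP (fun i => i.val < k) = l.countP (fun i => i.val < k) / 2 := by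
  induction l with
  | nil => simp [alternate]
  | cons a l ih =>
    rw [List.pairwise_cons] at hl
    obtain ⟨h1, h2⟩ := ih hl.2
    simp only [alternate, List.countP_cons, h1, h2, decide_eq_true_eq]
    split_ifs with ha
    · omega
    · have h0 : l.countP (fun i => i.val < k) = 0 := by
        rw [List.countP_eq_zero]
        intro b hb
        have : a.val ≤ b.val := hl.1 b hb
        simp only [decide_eq_true_eq]
        omega
      omega

theorem initialCount_sortPair (k : ℕ) (u v : Fin s →₀ ℕ) :
    initialCount k (sortPair u v).1 = (initialCount k u + initialCount k v + 1) / 2 ∧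
    initialCount k (sortPair u v).2 = (initialCount k u + initialCount k v) / 2 := by
  have h := countP_alternate k ((Finsupp.toMultiset (u + v)).sort (· ≤ ·))
    (Multiset.pairwise_sort _ _)
  have h2 : ((Finsupp.toMultiset (u + v)).sort (· ≤ ·)).countP (fun i => i.val < k)
      = initialCount k u + initialCount k v := by
    rw [← map_add, initialCount_apply, ← Multiset.coe_countP, Multiset.sort_eq]
  rw [h2] at h
  simp only [sortPair, initialCount_apply, Multiset.toFinsupp_toMultiset, Multiset.coe_countP]
  exact h

theorem sortPair_add (u v : Fin s →₀ ℕ) : (sortPair u v).1 + (sortPair u v).2 = u + v :=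
  eq_of_initialCount_eq fun k => by
    have := initialCount_sortPair k u v
    rw [map_add, map_add]
    omega

/-- Three functions that are pairwise balanced are determined by their sum, up to order: the
largest of them is a third of the sum, rounded up. -/
theorem exists_eq_ceil_third (N : Fin 3 → ℕ → ℕ)
    (h : ∀ i j, i ≠ j → (∀ k, N j k ≤ N i k ∧ N i k ≤ N j k + 1) ∨
      (∀ k, N i k ≤ N j k ∧ N j k ≤ N i k + 1)) :
    ∃ i, ∀ k, N i k = (N 0 k + N 1 k + N 2 k + 2) / 3 := by
  rcases h 0 1 (by decide) with h1 | h1 <;> rcases h 0 2 (by decide) with h2 | h2 <;>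
    rcases h 1 2 (by decide) with h3 | h3
  · exact ⟨0, fun k => by have := h1 k; have := h2 k; omega⟩
  · exact ⟨0, fun k => by have := h1 k; have := h2 k; omega⟩
  · exact ⟨0, fun k => by have := h1 k; have := h2 k; have := h3 k; omega⟩
  · exact ⟨2, fun k => by have := h3 k; have := h2 k; omega⟩
  · exact ⟨1, fun k => by have := h1 k; have := h3 k; omega⟩
  · exact ⟨0, fun k => by have := h1 k; have := h2 k; have := h3 k; omega⟩
  · exact ⟨1, fun k => by have := h1 k; have := h3 k; omega⟩
  · exact ⟨2, fun k => by have := h3 k; have := h2 k; omega⟩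

end Sorting

section SortableLattice

variable {L : Type*} [DistribLattice L] [BoundedOrder L] [Finite L]

/-- If `L` is sortable, then the maximal chains in a perfect matching of a hexagon are pairwise
sorted, as two of them are alone in their fibre. So both perfect matchings contain the
largest part of the sorted form of their common product. -/
theorem isPlanarLattice_of_isSortableLattice (h : IsSortableLattice L) : IsPlanarLattice L := by
  classical
  by_contra hL
  obtain ⟨H⟩ := nonempty_hexagon_of_not_isPlanarLattice hL
  obtain ⟨s, label, -, hs⟩ := h
  let U : MaxChain L → (Fin s →₀ ℕ) := fun C => (chainExponent C).mapDomain label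
  have hU : Function.Injective U :=
    (Finsupp.mapDomain_injective label.injective).comp chainExponent_injective
  have hfib : ∀ b, IsCubicFibre (chainExponent (L := L)) (H.matching b) (H.matching !b) := by
    rintro (_ | _)
    · exact H.isCubicFibre
    · exact H.isCubicFibre.symm
  have hpair : ∀ b i j, i ≠ j → sortPair (U (H.edge (i, b))) (U (H.edge (j, b)))
        = (U (H.edge (i, b)), U (H.edge (j, b))) ∨
      sortPair (U (H.edge (i, b))) (U (H.edge (j, b)))
        = (U (H.edge (j, b)), U (H.edge (i, b))) := by
    intro b i j hij
    obtain ⟨⟨D₁, hD₁⟩, ⟨D₂, hD₂⟩⟩ := hs _ ⟨H.edge (i, b), rfl⟩ _ ⟨H.edge (j, b), rfl⟩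
    have hadd := sortPair_add (U (H.edge (i, b))) (U (H.edge (j, b)))
    change U D₁ = _ at hD₁
    change U D₂ = _ at hD₂
    change U D₁ = (sortPair (U (H.edge (i, b))) (U (H.edge (j, b)))).1 at hD₁
    change U D₂ = (sortPair (U (H.edge (i, b))) (U (H.edge (j, b)))).2 at hD₂
    rw [← hD₁, ← hD₂, ← Finsupp.mapDomain_add, ← Finsupp.mapDomain_add] at hadd
    have hadd := Finsupp.mapDomain_injective label.injective hadd
    have hle : Finsupp.single (H.edge (i, b)) 1 + Finsupp.single (H.edge (j, b)) 1
        ≤ H.matching b := by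
      rw [Hexagon.matching, ← Finset.sum_pair (f := fun i => Finsupp.single (H.edge (i, b)) 1) hij]
      exact Finset.sum_le_sum_of_subset (Finset.subset_univ _)
    have heq := (hfib b).eq_of_le (b' := Finsupp.single D₁ 1 + Finsupp.single D₂ 1) hle (by simp)
      (by simpa only [map_add, multidegree_single] using hadd)
    have hmem : D₁ = H.edge (i, b) ∨ D₁ = H.edge (j, b) := by
      by_contra! hcon
      have := DFunLike.congr_fun heq D₁
      simp only [Finsupp.add_apply, Finsupp.single_eq_same, Finsupp.single_eq_of_ne hcon.1,
        Finsupp.single_eq_of_ne hcon.2] at this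
      omega
    rcases hmem with rfl | rfl
    · left
      have := Finsupp.single_left_injective one_ne_zero (add_left_cancel heq)
      subst this
      exact Prod.ext hD₁.symm hD₂.symm
    · right
      rw [add_comm (Finsupp.single (H.edge (i, b)) 1)] at heq
      have := Finsupp.single_left_injective one_ne_zero (add_left_cancel heq)
      subst this
      exact Prod.ext hD₁.symm hD₂.symm
  have hN : ∀ b, ∃ i, ∀ k, initialCount k (U (H.edge (i, b))) =
      (initialCount k (U (H.edge (0, b))) + initialCount k (U (H.edge (1, b)))
        + initialCount k (U (H.edge (2, b))) + 2) / 3 := by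
    intro b
    refine exists_eq_ceil_third (fun i k => initialCount k (U (H.edge (i, b)))) fun i j hij => ?_
    rcases hpair b i j hij with hp | hp
    · left
      intro k
      have := initialCount_sortPair k (U (H.edge (i, b))) (U (H.edge (j, b)))
      rw [hp] at this
      dsimp only at this ⊢
      omega
    · right
      intro k
      have := initialCount_sortPair k (U (H.edge (i, b))) (U (H.edge (j, b)))
      rw [hp] at this
      dsimp only at this ⊢
      omega
  have hsum : U (H.edge (0, false)) + U (H.edge (1, false)) + U (H.edge (2, false))
      = U (H.edge (0, true)) + U (H.edge (1, true)) + U (H.edge (2, true)) := by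
    have := H.multidegree_matching
    simp only [Hexagon.matching, Fin.sum_univ_three, map_add, multidegree_single] at this
    simp only [U, ← Finsupp.mapDomain_add, this]
  obtain ⟨i, hi⟩ := hN false
  obtain ⟨j, hj⟩ := hN true
  have hij : U (H.edge (i, false)) = U (H.edge (j, true)) := by
    refine eq_of_initialCount_eq fun k => ?_
    rw [hi, hj, ← map_add, ← map_add, ← map_add, ← map_add, hsum]
  have := congrArg Prod.snd (H.edge_injective (hU hij))
  simp at this

open Classical in
theorem initialCount_mapDomain_chainExponent [Fintype (Interior L)] {s : ℕ}
    (label : Interior L ≃ Fin s) (C : MaxChain L) (k : ℕ) :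
    initialCount k ((chainExponent C).mapDomain label) =
      (Finset.univ.filter fun x : Interior L => x.1 ∈ C.1 ∧ (label x).val < k).card := by
  classical
  have hsum : chainExponent C
      = ∑ x ∈ Finset.univ.filter (fun x : Interior L => x.1 ∈ C.1), Finsupp.single x 1 := by
    ext y
    rw [chainExponent_apply, Finsupp.finsetSum_apply]
    simp [Finsupp.single_apply]
  rw [hsum, Finsupp.mapDomain_finsetSum, map_sum]
  simp_rw [Finsupp.mapDomain_single, initialCount_single]
  rw [Finset.sum_boole, Finset.filter_filter, Nat.cast_id]

/-- Label the variables by rank, and by the first coordinate within each rank. Sorting the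
monomials of two maximal chains then yields the monomials of their infimum and their supremum. -/
theorem IsChainCover.isSortableLattice {A B : Set (JoinIrr L)} (h : IsChainCover A B)
    (hL : 2 ≤ rk (⊤ : L)) : IsSortableLattice L := by
  classical
  let key : Interior L → ℕ ×ₗ ℕ := fun x => toLex (rk x.1, coord A x.1)
  have hkey : Function.Injective key := by
    intro x y hxy
    have h1 : (rk x.1, coord A x.1) = (rk y.1, coord A y.1) := toLex.injective hxy
    rw [Prod.mk.injEq] at h1
    exact Subtype.ext (h.eq_of_coord_eq h1.1 h1.2)
  let _ : LinearOrder (Interior L) := LinearOrder.lift' key hkey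
  have := Fintype.ofFinite (Interior L)
  let f := (Fintype.orderIsoFinOfCardEq (Interior L) rfl).symm
  have hlt : ∀ x y : Interior L, rk x.1 < rk y.1 → (f x).val < (f y).val := fun x y hxy =>
    f.lt_iff_lt.2 (show key x < key y from Prod.Lex.toLex_lt_toLex.2 (Or.inl hxy))
  have hle : ∀ x y : Interior L, rk x.1 = rk y.1 → coord A x.1 ≤ coord A y.1 →
      (f x).val ≤ (f y).val := fun x y hxy hco =>
    f.le_iff_le.2 (show key x ≤ key y from Prod.Lex.toLex_le_toLex.2 (Or.inr ⟨hxy, hco⟩))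
  have hdeg : ∀ C : MaxChain L, ((chainExponent C).mapDomain f.toEquiv).degree
      = rk (⊤ : L) - 1 := fun C => by
    rw [← degree_chainExponent C]
    simp
  refine ⟨_, f.toEquiv, ⟨rk (⊤ : L) - 1, by omega, ?_⟩, ?_⟩
  · rintro _ ⟨C, rfl⟩
    exact hdeg C
  rintro _ ⟨C, rfl⟩ _ ⟨D, rfl⟩
  let U : MaxChain L → (Fin _ →₀ ℕ) := fun C => (chainExponent C).mapDomain f.toEquiv
  change (sortPair (U C) (U D)).1 ∈ Set.range U ∧ (sortPair (U C) (U D)).2 ∈ Set.range U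
  have hadd : U C + U D = U (h.chainInf C D) + U (h.chainSup C D) := by
    simp only [U, ← Finsupp.mapDomain_add, h.chainExponent_add C D]
  have hbal : ∀ k, initialCount k (U (h.chainSup C D)) ≤ initialCount k (U (h.chainInf C D)) ∧
      initialCount k (U (h.chainInf C D)) ≤ initialCount k (U (h.chainSup C D)) + 1 := by
    intro k
    -- The ranks in which the variable of a given maximal chain has a label less than `k`.
    let S : MaxChain L → Finset ℕ := fun E =>
      (Finset.univ.filter fun x : Interior L => x.1 ∈ E.1 ∧ (f x).val < k).image fun x => rk x.1
    have hS : ∀ E, initialCount k (U E) = (S E).card := by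
      intro E
      rw [Finset.card_image_of_injOn]
      · exact initialCount_mapDomain_chainExponent f.toEquiv E k
      · intro x hx y hy hxy
        exact Subtype.ext (MaxChain.eq_of_rk_eq (C := E) (by simpa using (Finset.mem_filter.1 hx).2.1)
          (by simpa using (Finset.mem_filter.1 hy).2.1) hxy)
    have hmem : ∀ (E : MaxChain L) (x : Interior L), x.1 = E.el (rk x.1) →
        (rk x.1 ∈ S E ↔ (f x).val < k) := by
      intro E x hx
      simp only [S, Finset.mem_image, Finset.mem_filter, Finset.mem_univ, true_and]
      constructor
      · rintro ⟨y, ⟨hyE, hyk⟩, hyx⟩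
        have : y = x := Subtype.ext (by rw [hx, ← hyx]; exact (MaxChain.el_rk hyE).symm)
        rwa [← this]
      · intro hxk
        exact ⟨x, ⟨MaxChain.mem_iff.2 hx.symm, hxk⟩, rfl⟩
    have hel : ∀ (E : MaxChain L) (j : ℕ), 0 < j → j < rk (⊤ : L) →
        ∃ x : Interior L, x.1 = E.el (rk x.1) ∧ rk x.1 = j := by
      intro E j hj0 hj
      refine ⟨⟨E.el j, interior_iff.2 (by rw [E.rk_el hj.le]; exact ⟨hj0, hj⟩)⟩, ?_, E.rk_el hj.le⟩
      change E.el j = E.el (rk (E.el j))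
      rw [E.rk_el hj.le]
    have hSrange : ∀ E, ∀ j ∈ S E, 0 < j ∧ j < rk (⊤ : L) := by
      intro E j hj
      obtain ⟨x, -, rfl⟩ := Finset.mem_image.1 hj
      exact interior_iff.1 x.2
    have hcoord : ∀ j ≤ rk (⊤ : L),
        coord A ((h.chainInf C D).el j) ≤ coord A ((h.chainSup C D).el j) := by
      intro j hj
      rw [h.el_chainInf _ _ hj, h.el_chainSup _ _ hj]
      split_ifs <;> omega
    have hsub : S (h.chainSup C D) ⊆ S (h.chainInf C D) := by
      intro j hj
      obtain ⟨hj0, hjt⟩ := hSrange _ j hj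
      obtain ⟨x, hx, hxj⟩ := hel (h.chainSup C D) j hj0 hjt
      obtain ⟨y, hy, hyj⟩ := hel (h.chainInf C D) j hj0 hjt
      rw [← hxj, hmem _ x hx] at hj
      rw [← hyj, hmem _ y hy]
      refine (hle y x (hyj.trans hxj.symm) ?_).trans_lt hj
      rw [hx, hy, hxj, hyj]
      exact hcoord j hjt.le
    have hdiff : (S (h.chainInf C D) \ S (h.chainSup C D)).card ≤ 1 := by
      rw [Finset.card_le_one_iff]
      have key : ∀ i j, i ∈ S (h.chainInf C D) \ S (h.chainSup C D) →
          j ∈ S (h.chainInf C D) \ S (h.chainSup C D) → ¬ i < j := by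
        intro i j hi hj hij
        rw [Finset.mem_sdiff] at hi hj
        obtain ⟨hi0, hit⟩ := hSrange _ i hi.1
        obtain ⟨hj0, hjt⟩ := hSrange _ j hj.1
        obtain ⟨x, hx, hxi⟩ := hel (h.chainSup C D) i hi0 hit
        obtain ⟨y, hy, hyj⟩ := hel (h.chainInf C D) j hj0 hjt
        have h1 := hi.2
        have h2 := hj.1
        rw [← hxi, hmem _ x hx] at h1
        rw [← hyj, hmem _ y hy] at h2
        have := hlt x y (by omega)
        omega
      intro i j hi hj
      have := key i j hi hj
      have := key j i hj hi
      omega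
    rw [hS, hS]
    have := Finset.card_sdiff_add_card_eq_card hsub
    omega
  have hsum : ∀ k, initialCount k (U C) + initialCount k (U D)
      = initialCount k (U (h.chainInf C D)) + initialCount k (U (h.chainSup C D)) := fun k => by
    rw [← map_add, hadd, map_add]
  constructor
  · refine ⟨h.chainInf C D, eq_of_initialCount_eq fun k => ?_⟩
    rw [(initialCount_sortPair k _ _).1, hsum]
    have := hbal k
    omega
  · refine ⟨h.chainSup C D, eq_of_initialCount_eq fun k => ?_⟩
    rw [(initialCount_sortPair k _ _).2, hsum]
    have := hbal k
    omega

end SortableLattice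

/-! ### Algebras isomorphic to a Hibi ring -/

section LinearPart

open MvPolynomial

variable {K : Type*} [Field K] {ι κ : Type*}

theorem exists_eq_single_of_degree_eq_one {e : ι →₀ ℕ} (he : e.degree = 1) :
    ∃ i, e = Finsupp.single i 1 := by
  obtain ⟨i, hi⟩ : e.support.Nonempty := by
    rw [Finsupp.support_nonempty_iff]
    rintro rfl
    simp at he
  have hle : Finsupp.single i 1 ≤ e :=
    Finsupp.single_le_iff.2 (Nat.one_le_iff_ne_zero.2 (Finsupp.mem_support_iff.1 hi))
  obtain ⟨c, rfl⟩ := exists_add_of_le hle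
  rw [map_add, Finsupp.degree_single] at he
  exact ⟨i, by rw [(Finsupp.degree_eq_zero_iff c).1 (by omega), add_zero]⟩

/-- The vector of coefficients of the linear part of a polynomial. -/
noncomputable def linearCoeff : MvPolynomial ι K →ₗ[K] (ι → K) :=
  LinearMap.pi fun i => MvPolynomial.lcoeff K (Finsupp.single i 1)

theorem linearCoeff_apply (f : MvPolynomial ι K) (i : ι) :
    linearCoeff f i = f.coeff (Finsupp.single i 1) := rfl

theorem linearCoeff_C (c : K) : linearCoeff (C c : MvPolynomial ι K) = 0 := by
  classical
  funext i
  rw [linearCoeff_apply, coeff_C, if_neg]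
  · rfl
  · exact (Finsupp.single_ne_zero.2 one_ne_zero).symm

theorem linearCoeff_X [DecidableEq ι] (i : ι) :
    linearCoeff (X i : MvPolynomial ι K) = Pi.single i 1 := by
  funext j
  rw [linearCoeff_apply, coeff_X, Pi.single_apply]
  have : Finsupp.single i 1 = Finsupp.single j 1 ↔ j = i :=
    ⟨fun h => (Finsupp.single_left_injective one_ne_zero h).symm, fun h => h ▸ rfl⟩
  simp only [this]

theorem linearCoeff_mul (f g : MvPolynomial ι K) : linearCoeff (f * g)
    = constantCoeff f • linearCoeff g + constantCoeff g • linearCoeff f := by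
  classical
  funext i
  rw [linearCoeff_apply, coeff_mul, Finsupp.antidiagonal_single]
  simp [Finset.Nat.antidiagonal_succ, linearCoeff_apply, constantCoeff_eq, mul_comm]

theorem linearCoeff_eq_zero {f : MvPolynomial ι K} (hf : f ∈ idealOfVars ι K ^ 2) :
    linearCoeff f = 0 := by
  funext i
  exact (mem_pow_idealOfVars_iff' _ _).1 hf _ (by simp)

theorem constantCoeff_eq_zero {f : MvPolynomial ι K} {n : ℕ} (hn : n ≠ 0)
    (hf : f ∈ idealOfVars ι K ^ n) : constantCoeff f = 0 :=
  (mem_pow_idealOfVars_iff' _ _).1 hf 0 (by simpa using Nat.pos_of_ne_zero hn)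

theorem mem_idealOfVars_iff {f : MvPolynomial ι K} :
    f ∈ idealOfVars ι K ↔ constantCoeff f = 0 := by
  rw [← pow_one (idealOfVars ι K), mem_pow_idealOfVars_iff']
  constructor
  · intro h
    exact h 0 (by simp)
  · intro h x hx
    rw [(Finsupp.degree_eq_zero_iff x).1 (by omega)]
    exact h

theorem mem_idealOfVars_sq {f : MvPolynomial ι K} (h0 : constantCoeff f = 0)
    (h1 : linearCoeff f = 0) : f ∈ idealOfVars ι K ^ 2 := by
  rw [mem_pow_idealOfVars_iff']
  intro x hx
  rcases Nat.lt_succ_iff_lt_or_eq.1 hx with hx | hx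
  · rw [(Finsupp.degree_eq_zero_iff x).1 (by omega)]
    exact h0
  · obtain ⟨i, rfl⟩ := exists_eq_single_of_degree_eq_one hx
    exact congrFun h1 i

/-- Linear parts of a composite lie in the span of the linear parts of the substituted
polynomials. -/
theorem linearCoeff_mem_span (ψ : MvPolynomial κ K →ₐ[K] MvPolynomial ι K)
    (f : MvPolynomial κ K) :
    linearCoeff (ψ f) ∈ Submodule.span K (Set.range fun a => linearCoeff (ψ (X a))) := by
  induction f using MvPolynomial.induction_on with
  | C c => rw [← algebraMap_eq, AlgHom.commutes, algebraMap_eq, linearCoeff_C]; exact zero_mem _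
  | add p q hp hq => rw [map_add, map_add]; exact add_mem hp hq
  | mul_X p a hp =>
    rw [map_mul, linearCoeff_mul]
    exact add_mem (Submodule.smul_mem _ _ (Submodule.subset_span ⟨a, rfl⟩))
      (Submodule.smul_mem _ _ hp)

theorem span_linearCoeff_eq_top [Finite ι] {I : Ideal (MvPolynomial ι K)}
    (hI : I ≤ idealOfVars ι K ^ 2)
    (φ : MvPolynomial ι K →ₐ[K] MvPolynomial κ K) (ψ : MvPolynomial κ K →ₐ[K] MvPolynomial ι K)
    (h : ∀ f, ψ (φ f) - f ∈ I) :
    Submodule.span K (Set.range fun a => linearCoeff (ψ (X a))) = ⊤ := by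
  classical
  rw [eq_top_iff, ← (Pi.basisFun K ι).span_eq, Submodule.span_le]
  rintro _ ⟨i, rfl⟩
  have h1 := linearCoeff_eq_zero (hI (h (X i)))
  rw [map_sub, sub_eq_zero, linearCoeff_X] at h1
  rw [Pi.basisFun_apply, ← h1]
  exact linearCoeff_mem_span ψ _

/-- The homogeneous part of degree `d` of the result of substituting polynomials without constant
term into a form of degree `d` is obtained by substituting their linear parts. -/
theorem aeval_sub_aeval_mem {p l : κ → MvPolynomial ι K} (hp : ∀ a, p a ∈ idealOfVars ι K)
    (hl : ∀ a, l a ∈ idealOfVars ι K) (hpl : ∀ a, p a - l a ∈ idealOfVars ι K ^ 2)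
    {d : ℕ} {f : MvPolynomial κ K} (hf : f.IsHomogeneous d) :
    aeval p f - aeval l f ∈ idealOfVars ι K ^ (d + 1) := by
  have hadd : ∀ {m n : ℕ} {a b a' b' : MvPolynomial ι K},
      a ∈ idealOfVars ι K ^ m → b' ∈ idealOfVars ι K ^ n →
      a - a' ∈ idealOfVars ι K ^ (m + 1) → b - b' ∈ idealOfVars ι K ^ (n + 1) →
      a * b - a' * b' ∈ idealOfVars ι K ^ (m + n + 1) := by
    intro m n a b a' b' ha hb' haa' hbb'
    have h1 := Ideal.mul_mem_mul ha hbb'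
    have h2 := Ideal.mul_mem_mul haa' hb'
    rw [← pow_add] at h1 h2
    rw [show m + 1 + n = m + n + 1 by omega] at h2
    rw [← add_assoc] at h1
    have h3 := Ideal.add_mem _ h1 h2
    convert h3 using 1
    ring
  have hmon : ∀ e : κ →₀ ℕ, aeval p (monomial e (1 : K)) ∈ idealOfVars ι K ^ e.degree ∧
      aeval l (monomial e (1 : K)) ∈ idealOfVars ι K ^ e.degree ∧
      aeval p (monomial e (1 : K)) - aeval l (monomial e (1 : K))
        ∈ idealOfVars ι K ^ (e.degree + 1) := by
    have hstep : ∀ (a : κ) (n : ℕ), p a ^ n ∈ idealOfVars ι K ^ n ∧ l a ^ n ∈ idealOfVars ι K ^ n ∧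
        p a ^ n - l a ^ n ∈ idealOfVars ι K ^ (n + 1) := by
      intro a n
      refine ⟨Ideal.pow_mem_pow (hp a) n, Ideal.pow_mem_pow (hl a) n, ?_⟩
      induction n with
      | zero => simp
      | succ n ih =>
        rw [pow_succ, pow_succ (l a)]
        refine hadd (n := 1) (Ideal.pow_mem_pow (hp a) n) ?_ ih (hpl a)
        rw [pow_one]
        exact hl a
    intro e
    induction e using Finsupp.induction_linear with
    | zero => simp
    | add f g hf hg =>
      rw [← one_mul (1 : K), ← monomial_mul, map_mul, map_mul, map_add]
      refine ⟨?_, ?_, hadd hf.1 hg.2.1 hf.2.2 hg.2.2⟩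
      · rw [pow_add]; exact Ideal.mul_mem_mul hf.1 hg.1
      · rw [pow_add]; exact Ideal.mul_mem_mul hf.2.1 hg.2.1
    | single a n =>
      simp only [aeval_monomial, map_one, one_mul, Finsupp.degree_single]
      have hprod : ∀ p : κ → MvPolynomial ι K,
          (Finsupp.single a n).prod (fun i k => p i ^ k) = p a ^ n := fun p =>
        Finsupp.prod_single_index (h := fun i k => p i ^ k) (pow_zero _)
      rw [hprod, hprod]
      exact hstep a n
  rw [f.as_sum, map_sum, map_sum, ← Finset.sum_sub_distrib]
  refine Ideal.sum_mem _ fun e he => ?_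
  have hd : e.degree = d := by
    by_contra hne
    exact (mem_support_iff.1 he) (hf.coeff_eq_zero hne)
  rw [← mul_one (coeff e f), ← C_mul_monomial, map_mul, map_mul, ← algebraMap_eq,
    AlgHom.commutes, AlgHom.commutes, ← mul_sub, ← hd]
  exact Ideal.mul_mem_left _ _ (hmon e).2.2

theorem map_mem_pow_idealOfVars (φ : MvPolynomial ι K →ₐ[K] MvPolynomial κ K)
    (hφ : ∀ i, φ (X i) ∈ idealOfVars κ K) {n : ℕ} {f : MvPolynomial ι K}
    (hf : f ∈ idealOfVars ι K ^ n) : φ f ∈ idealOfVars κ K ^ n := by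
  have h1 : (idealOfVars ι K).map (φ : MvPolynomial ι K →+* MvPolynomial κ K)
      ≤ idealOfVars κ K := by
    rw [idealOfVars, Ideal.map_span, Ideal.span_le]
    rintro _ ⟨_, ⟨i, rfl⟩, rfl⟩
    exact hφ i
  have h2 := Ideal.mem_map_of_mem (φ : MvPolynomial ι K →+* MvPolynomial κ K) hf
  rw [Ideal.map_pow] at h2
  exact Ideal.pow_right_mono h1 n h2

theorem homogeneousComponent_eq_of_sub_mem {d : ℕ} {f g : MvPolynomial ι K}
    (hg : g.IsHomogeneous d) (h : f - g ∈ idealOfVars ι K ^ (d + 1)) :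
    homogeneousComponent d f = g := by
  rw [← homogeneousComponent_eq_self hg, ← sub_eq_zero, ← map_sub]
  ext x
  rw [coeff_homogeneousComponent, coeff_zero]
  split_ifs with hx
  · exact (mem_pow_idealOfVars_iff' _ _).1 h x (by omega)
  · rfl

attribute [local instance] MvPolynomial.gradedAlgebra in
theorem homogeneousComponent_mem_span {G : Set (MvPolynomial ι K)} {r : ℕ}
    (hG : ∀ g ∈ G, g.IsHomogeneous r) {f : MvPolynomial ι K} (hf : f ∈ Ideal.span G) (d : ℕ) :
    homogeneousComponent d f ∈ Ideal.span G :=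
  homogeneousComponent_mem_of_mem
    (Ideal.homogeneous_span _ _ fun g hg => ⟨r, (mem_homogeneousSubmodule _ _).2 (hG g hg)⟩) hf d

/-- If `K[T]/I ≅ K[x]/J` compatibly with the augmentations, where `I` is homogeneous and `J` is
generated by quadrics, then replacing the isomorphism by its linear part shows that `I` is
generated by quadrics. -/
theorem isQuadraticallyGenerated_of_augmented [Finite ι] {I : Ideal (MvPolynomial ι K)}
    {J : Ideal (MvPolynomial κ K)} (hIhom : ∀ f ∈ I, ∀ d, homogeneousComponent d f ∈ I)
    (hJ : IsQuadraticallyGenerated J)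
    (φ : MvPolynomial ι K →ₐ[K] MvPolynomial κ K) (ψ : MvPolynomial κ K →ₐ[K] MvPolynomial ι K)
    (hφ : ∀ i, φ (X i) ∈ idealOfVars κ K) (hψ : ∀ a, ψ (X a) ∈ idealOfVars ι K)
    (hφI : ∀ f ∈ I, φ f ∈ J) (hψJ : ∀ g ∈ J, ψ g ∈ I) (hφψ : ∀ g, φ (ψ g) - g ∈ J)
    (hspan : Submodule.span K (Set.range fun a => linearCoeff (ψ (X a))) = ⊤) :
    IsQuadraticallyGenerated I := by
  classical
  obtain ⟨G, hG, rfl⟩ := hJ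
  let l : κ → MvPolynomial ι K := fun a => homogeneousComponent 1 (ψ (X a))
  have hl1 : ∀ a, (l a).IsHomogeneous 1 := fun a => homogeneousComponent_isHomogeneous 1 _
  have hl : ∀ a, l a ∈ idealOfVars ι K := fun a => by
    rw [mem_idealOfVars_iff]
    exact (hl1 a).coeff_eq_zero (by simp)
  have hlin : ∀ a, linearCoeff (l a) = linearCoeff (ψ (X a)) := fun a => by
    funext i
    rw [linearCoeff_apply, linearCoeff_apply, coeff_homogeneousComponent, if_pos (by simp)]
  have hpl : ∀ a, ψ (X a) - l a ∈ idealOfVars ι K ^ 2 := fun a => by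
    refine mem_idealOfVars_sq ?_ ?_
    · rw [map_sub, mem_idealOfVars_iff.1 (hψ a), mem_idealOfVars_iff.1 (hl a), sub_zero]
    · rw [map_sub, hlin, sub_self]
  have hψa : ψ = aeval fun a => ψ (X a) := algHom_ext fun a => by rw [aeval_X]
  -- Substituting the linear parts `l` only changes terms of higher degree.
  have hlow : ∀ {d : ℕ} {g : MvPolynomial κ K}, g.IsHomogeneous d →
      ψ g - aeval l g ∈ idealOfVars ι K ^ (d + 1) := by
    intro d g hg
    have := aeval_sub_aeval_mem hψ hl hpl hg
    rwa [← hψa] at this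
  have hlhom : ∀ {d : ℕ} {g : MvPolynomial κ K}, g.IsHomogeneous d →
      (aeval l g).IsHomogeneous d := by
    intro d g hg
    have := hg.aeval l hl1
    rwa [one_mul] at this
  have hlI : ∀ g ∈ G, aeval l g ∈ I := by
    intro g hg
    rw [← homogeneousComponent_eq_of_sub_mem (hlhom (hG g hg)) (hlow (hG g hg))]
    exact hIhom _ (hψJ g (Ideal.subset_span hg)) 2
  -- A linear section of the linearization.
  have hsec : ∀ i : ι, ∃ q : MvPolynomial κ K, q.IsHomogeneous 1 ∧ aeval l q = X i := by
    have key : ∀ v ∈ Submodule.span K (Set.range fun a => linearCoeff (ψ (X a))),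
        ∃ q : MvPolynomial κ K, q.IsHomogeneous 1 ∧ linearCoeff (aeval l q) = v := by
      intro v hv
      induction hv using Submodule.span_induction with
      | mem v hv =>
        obtain ⟨a, rfl⟩ := hv
        exact ⟨X a, isHomogeneous_X _ _, by rw [aeval_X, hlin]⟩
      | zero => exact ⟨0, isHomogeneous_zero _ _ _, by simp⟩
      | add v w _ _ hv hw =>
        obtain ⟨q, hq, rfl⟩ := hv
        obtain ⟨q', hq', rfl⟩ := hw
        exact ⟨q + q', hq.add hq', by rw [map_add, map_add]⟩
      | smul c v _ hv =>
        obtain ⟨q, hq, rfl⟩ := hv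
        exact ⟨c • q, by rw [smul_eq_C_mul]; exact hq.C_mul c, by rw [map_smul, map_smul]⟩
    intro i
    obtain ⟨q, hq, hqv⟩ := key (Pi.single i 1) (hspan ▸ Submodule.mem_top)
    refine ⟨q, hq, ?_⟩
    have h1 : aeval l q - X i ∈ idealOfVars ι K ^ 2 := by
      refine mem_idealOfVars_sq ?_ ?_
      · rw [constantCoeff_eq, ((hlhom hq).sub (isHomogeneous_X _ i)).coeff_eq_zero (by simp)]
      · rw [map_sub, hqv, linearCoeff_X, sub_self]
    rw [← homogeneousComponent_eq_self (hlhom hq)]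
    exact homogeneousComponent_eq_of_sub_mem (isHomogeneous_X _ i) h1
  choose q hq hqX using hsec
  have hχ : ∀ f : MvPolynomial ι K, aeval l (aeval q f) = f := by
    intro f
    have : (aeval l).comp (aeval q) = AlgHom.id K (MvPolynomial ι K) :=
      algHom_ext fun i => by
        rw [AlgHom.comp_apply, aeval_X, hqX, AlgHom.id_apply]
    exact DFunLike.congr_fun this f
  refine ⟨(aeval l : MvPolynomial κ K →ₐ[K] MvPolynomial ι K) '' G, ?_, le_antisymm ?_ ?_⟩
  · rintro _ ⟨g, hg, rfl⟩
    exact hlhom (hG g hg)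
  · intro f hf
    rw [← sum_homogeneousComponent f]
    refine Ideal.sum_mem _ fun d _ => ?_
    set f' := homogeneousComponent d f with hf'
    have hfd : f'.IsHomogeneous d := homogeneousComponent_isHomogeneous d f
    have hfI : f' ∈ I := hIhom f hf d
    set g := aeval q f' with hg
    have hgd : g.IsHomogeneous d := by
      have := hfd.aeval q hq
      rwa [one_mul] at this
    have hlg : aeval l g = f' := hχ f'
    have h1 := map_mem_pow_idealOfVars φ hφ (hlow hgd)
    rw [hlg, map_sub] at h1
    -- `g` agrees with an element of the homogeneous ideal up to terms of higher degree.
    have h2 : φ f' - (φ (ψ g) - g) ∈ Ideal.span G := Ideal.sub_mem _ (hφI _ hfI) (hφψ g)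
    have h3 : homogeneousComponent d (φ f' - (φ (ψ g) - g)) = g := by
      refine homogeneousComponent_eq_of_sub_mem hgd ?_
      have := Ideal.neg_mem_iff _ |>.2 h1
      convert this using 1
      ring
    have h4 : g ∈ Ideal.span G := h3 ▸ homogeneousComponent_mem_span hG h2 d
    rw [← hlg]
    have := Ideal.mem_map_of_mem (aeval l : MvPolynomial κ K →ₐ[K] MvPolynomial ι K) h4
    rwa [Ideal.map_span] at this
  · rw [Ideal.span_le]
    rintro _ ⟨g, hg, rfl⟩
    exact hlI g hg

theorem IsQuadraticallyGenerated.le_idealOfVars_sq {I : Ideal (MvPolynomial ι K)}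
    (h : IsQuadraticallyGenerated I) : I ≤ idealOfVars ι K ^ 2 := by
  obtain ⟨G, hG, rfl⟩ := h
  rw [Ideal.span_le]
  intro g hg
  exact (mem_pow_idealOfVars_iff' _ _).2 fun x hx => (hG g hg).coeff_eq_zero hx.ne

end LinearPart

section HibiRing

open MvPolynomial

variable {K : Type*} [Field K] {ι M : Type*}

/-- A translation of the variables preserves the Hibi ideal if it fixes all variables that occur in
a nontrivial relation. -/
theorem aeval_X_add_C_mem_hibiIdeal [Lattice M] {η : M → K}
    (hη : ∀ a b : M, ¬ a ≤ b → ¬ b ≤ a → η a = 0 ∧ η b = 0 ∧ η (a ⊓ b) = 0 ∧ η (a ⊔ b) = 0)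
    {f : MvPolynomial M K} (hf : f ∈ hibiIdeal K M) :
    aeval (fun a => X a + C (η a) : M → MvPolynomial M K) f ∈ hibiIdeal K M := by
  have hmap : (hibiIdeal K M).map (aeval (fun a => X a + C (η a) : M → MvPolynomial M K) :
        MvPolynomial M K →ₐ[K] MvPolynomial M K) ≤ hibiIdeal K M := by
    conv_lhs => rw [hibiIdeal]
    rw [Ideal.map_span, Ideal.span_le]
    rintro _ ⟨_, ⟨a, b, rfl⟩, rfl⟩
    change aeval _ _ ∈ hibiIdeal K M
    by_cases hab : a ≤ b
    · rw [inf_eq_left.2 hab, sup_eq_right.2 hab, sub_self, map_zero]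
      exact Ideal.zero_mem _
    by_cases hba : b ≤ a
    · rw [inf_eq_right.2 hba, sup_eq_left.2 hba, mul_comm, sub_self, map_zero]
      exact Ideal.zero_mem _
    obtain ⟨h1, h2, h3, h4⟩ := hη a b hab hba
    simp only [map_sub, map_mul, aeval_X, h1, h2, h3, h4, C_0, add_zero]
    exact Ideal.subset_span ⟨a, b, rfl⟩
  exact hmap (Ideal.mem_map_of_mem _ hf)

theorem exists_lift_of_algEquiv {κ : Type*} {I : Ideal (MvPolynomial ι K)}
    {J : Ideal (MvPolynomial κ K)} (e : (MvPolynomial ι K ⧸ I) ≃ₐ[K] (MvPolynomial κ K ⧸ J)) :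
    ∃ φ : MvPolynomial ι K →ₐ[K] MvPolynomial κ K,
      ∀ f, Ideal.Quotient.mk J (φ f) = e (Ideal.Quotient.mk I f) := by
  choose t ht using fun i : ι => Ideal.Quotient.mk_surjective (e (Ideal.Quotient.mk I (X i)))
  refine ⟨aeval t, fun f => ?_⟩
  have : (Ideal.Quotient.mkₐ K J).comp (aeval t)
      = (e : _ →ₐ[K] _).comp (Ideal.Quotient.mkₐ K I) :=
    algHom_ext fun i => by simpa using ht i
  exact DFunLike.congr_fun this f

/-- If a homogeneous ideal without linear forms defines an algebra that is isomorphic, as an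
ungraded algebra, to a Hibi ring, then it is generated by quadrics. The point of the spectrum of the
Hibi ring that corresponds to the origin has a cotangent space of maximal dimension. So
its coordinates vanish at all variables that occur in a nontrivial Hibi relation, and
a translation of the other variables moves it to the origin. -/
theorem isQuadraticallyGenerated_of_algEquiv_hibiRing [Finite ι] [Finite M] [Lattice M]
    {I : Ideal (MvPolynomial ι K)} (hIhom : ∀ f ∈ I, ∀ d, homogeneousComponent d f ∈ I)
    (hI : I ≤ idealOfVars ι K ^ 2) (e : (MvPolynomial ι K ⧸ I) ≃ₐ[K] HibiRing K M) :
    IsQuadraticallyGenerated I := by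
  classical
  have := Fintype.ofFinite ι
  have := Fintype.ofFinite M
  have hJ := (isQuadraticallyGenerated_hibiIdeal (K := K) (M := M)).le_idealOfVars_sq
  obtain ⟨φ, hφ⟩ := exists_lift_of_algEquiv e
  obtain ⟨ψ, hψ⟩ := exists_lift_of_algEquiv e.symm
  have hφI : ∀ f ∈ I, φ f ∈ hibiIdeal K M := fun f hf => by
    rw [← Ideal.Quotient.eq_zero_iff_mem, hφ, Ideal.Quotient.eq_zero_iff_mem.2 hf, map_zero]
  have hψJ : ∀ g ∈ hibiIdeal K M, ψ g ∈ I := fun g hg => by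
    rw [← Ideal.Quotient.eq_zero_iff_mem, hψ, Ideal.Quotient.eq_zero_iff_mem.2 hg, map_zero]
  have hψφ : ∀ f, ψ (φ f) - f ∈ I := fun f => by
    rw [← Ideal.Quotient.eq_zero_iff_mem, map_sub, hψ, hφ, AlgEquiv.symm_apply_apply, sub_self]
  have hφψ : ∀ g, φ (ψ g) - g ∈ hibiIdeal K M := fun g => by
    rw [← Ideal.Quotient.eq_zero_iff_mem, map_sub, hφ, hψ, AlgEquiv.apply_symm_apply, sub_self]
  -- The linear parts of the images of the variables form a basis.
  have hspan := span_linearCoeff_eq_top hI φ ψ hψφ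
  have hspan' := span_linearCoeff_eq_top hJ ψ φ hφψ
  have hcard : Fintype.card M = Module.finrank K (ι → K) := by
    rw [Module.finrank_fintype_fun_eq_card]
    apply le_antisymm
    · have h1 := finrank_range_le_card (R := K) (fun i => linearCoeff (φ (X i)))
      rw [Set.finrank, hspan', finrank_top, Module.finrank_fintype_fun_eq_card] at h1
      exact h1
    · have h1 := finrank_range_le_card (R := K) (fun a => linearCoeff (ψ (X a)))
      rw [Set.finrank, hspan, finrank_top, Module.finrank_fintype_fun_eq_card] at h1
      exact h1
  have hli := linearIndependent_of_top_le_span_of_card_eq_finrank hspan.ge hcard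
  set ε : M → K := fun a => constantCoeff (ψ (X a)) with hε
  have hvanish : ∀ a b : M, ¬ a ≤ b → ¬ b ≤ a →
      ε a = 0 ∧ ε b = 0 ∧ ε (a ⊓ b) = 0 ∧ ε (a ⊔ b) = 0 := by
    intro a b hab hba
    have h1 := linearCoeff_eq_zero (hI (hψJ _ (Ideal.subset_span ⟨a, b, rfl⟩)))
    simp only [map_sub, map_mul, linearCoeff_mul] at h1
    have hne1 : a ≠ b := fun h => hab h.le
    have hne2 : a ⊓ b ≠ a := fun h => hab (inf_eq_left.1 h)
    have hne3 : a ⊓ b ≠ b := fun h => hba (inf_eq_right.1 h)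
    have hne4 : a ⊔ b ≠ a := fun h => hba (sup_eq_left.1 h)
    have hne5 : a ⊔ b ≠ b := fun h => hab (sup_eq_right.1 h)
    have hne6 : a ⊓ b ≠ a ⊔ b := fun h => hne2 (le_antisymm inf_le_left (h ▸ le_sup_left))
    rw [Fintype.linearIndependent_iff] at hli
    have h2 := hli (Pi.single b (ε a) + Pi.single a (ε b) - Pi.single (a ⊔ b) (ε (a ⊓ b))
      - Pi.single (a ⊓ b) (ε (a ⊔ b))) (by
        simp only [Pi.sub_apply, Pi.add_apply, sub_smul, add_smul, Finset.sum_sub_distrib,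
          Finset.sum_add_distrib, Pi.single_apply, ite_smul, zero_smul, Finset.sum_ite_eq',
          Finset.mem_univ, if_true]
        rw [← h1]
        abel)
    have ha := h2 a
    have hb := h2 b
    have hinf := h2 (a ⊓ b)
    have hsup := h2 (a ⊔ b)
    simp only [Pi.sub_apply, Pi.add_apply, Pi.single_apply, hne1, hne2, hne3, hne4, hne5, hne6,
      hne1.symm, hne2.symm, hne3.symm, hne4.symm, hne5.symm, hne6.symm, if_true, if_false,
      zero_add, add_zero, zero_sub, sub_zero, neg_eq_zero] at ha hb hinf hsup
    exact ⟨hb, ha, hsup, hinf⟩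
  let τ : MvPolynomial M K →ₐ[K] MvPolynomial M K := aeval fun a => X a + C (ε a)
  let τ' : MvPolynomial M K →ₐ[K] MvPolynomial M K := aeval fun a => X a + C (-ε a)
  have hττ' : ∀ g, τ (τ' g) = g := by
    intro g
    have : τ.comp τ' = AlgHom.id K _ := algHom_ext fun a => by simp [τ, τ']
    exact DFunLike.congr_fun this g
  have hτ : ∀ g ∈ hibiIdeal K M, τ g ∈ hibiIdeal K M := fun g hg =>
    aeval_X_add_C_mem_hibiIdeal hvanish hg
  have hτ' : ∀ g ∈ hibiIdeal K M, τ' g ∈ hibiIdeal K M := fun g hg =>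
    aeval_X_add_C_mem_hibiIdeal (η := fun a => -ε a) (fun a b hab hba => by
      simpa using hvanish a b hab hba) hg
  have hconst : ∀ g, constantCoeff (τ g) = constantCoeff (ψ g) := by
    intro g
    have : (aeval (fun _ => (0 : K)) : MvPolynomial M K →ₐ[K] K).comp τ
        = (aeval (fun _ => (0 : K)) : MvPolynomial ι K →ₐ[K] K).comp ψ := algHom_ext fun a => by
      simp [τ, hε]
    have h1 := DFunLike.congr_fun this g
    simpa [aeval_zero'] using h1
  have hψτ : ∀ a, ψ (τ' (X a)) = ψ (X a) - C (ε a) := fun a => by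
    simp only [τ', aeval_X, map_add, map_neg]
    rw [← algebraMap_eq, ← algebraMap_eq, AlgHom.commutes, sub_eq_add_neg]
  refine isQuadraticallyGenerated_of_augmented hIhom isQuadraticallyGenerated_hibiIdeal
    (τ.comp φ) (ψ.comp τ') (fun i => ?_) (fun a => ?_) (fun f hf => hτ _ (hφI f hf))
    (fun g hg => hψJ _ (hτ' g hg)) (fun g => ?_) ?_
  · rw [mem_idealOfVars_iff, AlgHom.comp_apply, hconst]
    have h1 := constantCoeff_eq_zero two_ne_zero (hI (hψφ (X i)))
    rw [map_sub, constantCoeff_X, sub_zero] at h1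
    exact h1
  · rw [mem_idealOfVars_iff, AlgHom.comp_apply, hψτ, map_sub, constantCoeff_C, sub_self]
  · have h1 := hτ _ (hφψ (τ' g))
    rw [map_sub, hττ'] at h1
    exact h1
  · rw [← hspan]
    congr 2
    funext a
    rw [AlgHom.comp_apply, hψτ, map_sub, linearCoeff_C, sub_zero]

end HibiRing

section ChainAlgebraHibi

variable {K : Type*} [Field K] {L : Type*} [DistribLattice L] [BoundedOrder L] [Finite L]

theorem toricIdeal_le_idealOfVars_sq {ι σ : Type*} {u : ι → (σ →₀ ℕ)} {r : ℕ} (hr : 0 < r)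
    (hu : ∀ i, (u i).degree = r) (hinj : Function.Injective u) :
    toricIdeal K u ≤ MvPolynomial.idealOfVars ι K ^ 2 := by
  intro f hf
  refine (MvPolynomial.mem_pow_idealOfVars_iff' _ _).2 fun e he => ?_
  refine coeff_eq_zero_of_mem_toricIdeal hf fun e' he' => ?_
  have hdeg : e'.degree = e.degree := by
    have := congrArg Finsupp.degree he'
    rw [degree_multidegree hu, degree_multidegree hu] at this
    exact Nat.eq_of_mul_eq_mul_right hr this
  rcases Nat.lt_succ_iff_lt_or_eq.1 he with h0 | h1
  · rw [(Finsupp.degree_eq_zero_iff e).1 (by omega), (Finsupp.degree_eq_zero_iff e').1 (by omega)]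
  · obtain ⟨i, rfl⟩ := exists_eq_single_of_degree_eq_one h1
    obtain ⟨j, rfl⟩ := exists_eq_single_of_degree_eq_one (hdeg.trans h1)
    rw [multidegree_single, multidegree_single] at he'
    rw [hinj he']

theorem isQuadraticallyGenerated_of_isHibiRing (hL : 2 ≤ rk (⊤ : L))
    (h : IsHibiRing K (chainAlgebra K L)) : IsQuadraticallyGenerated (chainIdeal K L) := by
  obtain ⟨M, _, _, -, ⟨e⟩⟩ := h
  obtain ⟨e', -⟩ := exists_quotient_chainIdeal_algEquiv (K := K) (L := L)
  exact isQuadraticallyGenerated_of_algEquiv_hibiRing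
    (fun f hf d => homogeneousComponent_mem_toricIdeal (by omega) degree_chainExponent hf d)
    (toricIdeal_le_idealOfVars_sq (by omega) degree_chainExponent chainExponent_injective)
    (e'.trans e)

end ChainAlgebraHibi

/-! ### The equivalence -/

theorem theorem3p2 (K : Type*) [Field K] (L : Type*) [DistribLattice L] [BoundedOrder L]
    [Finite L] (hL : 3 ≤ Nat.card L) :
    List.TFAE [
      IsPlanarLattice L,
      IsSortableLattice L,
      ∃ (m : ℕ) (C : Fin m ≃ MaxChain L),
        HasQuadraticGroebnerBasis (degRevLex m) (chainIdealEnum K C),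
      IsQuadraticallyGenerated (chainIdeal K L),
      IsHibiRing K (chainAlgebra K L)] ∧
    (IsPlanarLattice L → ∃ A B : Set (JoinIrr L), IsChainCover A B) ∧
    ∀ A B : Set (JoinIrr L), IsChainCover A B →
      (∃ inst : DistribLattice (MaxChain L),
        (∀ C D : MaxChain L, C ≤ D ↔ ChainLE A B C D) ∧
        ∃ e : HibiRing K (MaxChain L) ≃ₐ[K] chainAlgebra K L, ∀ C : MaxChain L,
          (e (Ideal.Quotient.mk (hibiIdeal K (MaxChain L)) (MvPolynomial.X C)) :
            MvPolynomial (Interior L) K) = chainMonomial K C) ∧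
      ∀ (m : ℕ) (C : Fin m ≃ MaxChain L), (∀ i j, ChainLE A B (C i) (C j) → i ≤ j) →
        HasQuadraticGroebnerBasis (degRevLex m) (chainIdealEnum K C) := by
  have hrk := two_le_rk_top hL
  refine ⟨?_, exists_isChainCover, fun A B h => ⟨⟨h.chainLattice, fun C D => Iff.rfl,
    h.exists_hibiRing_algEquiv hrk⟩, fun m C hC => h.hasQuadraticGroebnerBasis hrk C hC⟩⟩
  tfae_have 1 → 2 := fun h => by
    obtain ⟨A, B, hAB⟩ := exists_isChainCover h
    exact hAB.isSortableLattice hrk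
  tfae_have 2 → 1 := isPlanarLattice_of_isSortableLattice
  tfae_have 1 → 3 := fun h => by
    obtain ⟨A, B, hAB⟩ := exists_isChainCover h
    exact hAB.exists_hasQuadraticGroebnerBasis hrk
  tfae_have 3 → 1 := fun ⟨_, C, h⟩ => isPlanarLattice_of_hasQuadraticGroebnerBasis C h
  tfae_have 4 → 1 := isPlanarLattice_of_isQuadraticallyGenerated
  tfae_have 1 → 5 := fun h => by
    obtain ⟨A, B, hAB⟩ := exists_isChainCover h
    exact hAB.isHibiRing hrk
  tfae_have 5 → 4 := isQuadraticallyGenerated_of_isHibiRing hrk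
  tfae_finish
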